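/- Let ${\cal N}$ be a von Neumann algebra on a complex Hilbert space ${\cal H}$ with a normal semifinite faithful trace ${\cal T}$, and let $({\cal N},D,\mathscr{A})$ be a semifinite spectral triple: $D$ is a self-adjoint operator affiliated with ${\cal N}$ and $\mathscr{A}\subset{\cal N}$ is a $*$-algebra such that each $A\in\mathscr{A}$ preserves $\mathrm{Dom}(D)$, $[D,A]$ extends from $\mathrm{Dom}(D)$ to a bounded element of ${\cal N}$, and $A(1+D^2)^{-1/2}$ lies in the norm closure of $\{B\in{\cal N}:{\cal T}(|B|)<\infty\}$. Let ${\cal A}$ be the norm closure of $\mathscr{A}$ and let $M({\cal A},{\cal N})=\{m\in{\cal N}: m{\cal A}\subset{\cal A},\ {\cal A}m\subset{\cal A}\}$. An unbounded ${\cal A}$-multiplier is a closed densely defined (possibly unbounded) operator $T$ affiliated with ${\cal N}$ such that its bounded transform $F(T)=T(1+T^*T)^{-1/2}$ lies in $M({\cal A},{\cal N})$ and $(1+T^*T)^{-1/2}{\cal A}$ is a dense subset of ${\cal A}$. A self-adjoint operator $H$ affiliated with ${\cal N}$ is called $D$-differentiable if there is a core ${\cal E}$ of $D$ such that for every $\mu\in\mathbb{R}\setminus\{0\}$: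 (i) $(H-i\mu)^{-1}{\cal E}\subset\mathrm{Dom}(D)\cap\mathrm{Dom}(H)$ and $D(H-i\mu)^{-1}{\cal E}\subset\mathrm{Dom}(H)$; (ii) $[D,H](H-i\mu)^{-1}$ extends from ${\cal E}$ to a bounded operator in ${\cal N}$. Let $H$ be an unbounded ${\cal A}$-multiplier that is self-adjoint and $D$-differentiable. Then $F(H)$ is $D$-differentiable. Moreover $F(H)$ preserves $\mathrm{Dom}(D)$, the commutator $[D,F(H)]$ extends from $\mathrm{Dom}(D)$ to a bounded operator in ${\cal N}$, and $$\|[D,F(H)]\|\le\|[D,H](H+i)^{-1}\|,$$ where the norms are those of the bounded extensions, the one on the right being taken from any core ${\cal E}$ of $D$ for which (i) and (ii) hold. -/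

import Mathlib

open scoped ENNReal NNReal ComplexOrder InnerProductSpace

namespace Callias

section Operators

variable {E : Type*} [NormedAddCommGroup E] [InnerProductSpace ℂ E]

/-- The product `S T` of two unbounded operators, on its natural domain
`{x ∈ Dom T | T x ∈ Dom S}`. -/
def pcomp (S T : E →ₗ.[ℂ] E) : E →ₗ.[ℂ] E where
  domain := (S.domain.comap T.toFun).map T.domain.subtype
  toFun :=
    { toFun := fun x => S ⟨T ⟨x, by
          obtain ⟨y, -, hy⟩ := Submodule.mem_map.1 x.2
          rw [← hy]; exact y.2⟩, by
          obtain ⟨x, hx⟩ := x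
          obtain ⟨y, hy, rfl⟩ := Submodule.mem_map.1 hx
          exact hy⟩
      map_add' := fun x y => by
        rw [← S.map_add]
        congr 1
        apply Subtype.ext
        change _ = T _ + T _
        rw [← T.map_add]
        rfl
      map_smul' := fun c x => by
        rw [RingHom.id_apply, ← S.map_smul]
        congr 1
        apply Subtype.ext
        change _ = c • T _
        rw [← T.map_smul]
        rfl }

theorem mem_pcomp_domain {S T : E →ₗ.[ℂ] E} {x : E} :
    x ∈ (pcomp S T).domain ↔ ∃ hx : x ∈ T.domain, T ⟨x, hx⟩ ∈ S.domain := by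
  constructor
  · intro h
    obtain ⟨y, hy, rfl⟩ := Submodule.mem_map.1 h
    exact ⟨y.2, hy⟩
  · rintro ⟨hx, h⟩
    exact Submodule.mem_map.2 ⟨⟨x, hx⟩, h, rfl⟩

theorem pcomp_apply {S T : E →ₗ.[ℂ] E} {x : E} (hx : x ∈ T.domain) (h : T ⟨x, hx⟩ ∈ S.domain) :
    pcomp S T ⟨x, mem_pcomp_domain.2 ⟨hx, h⟩⟩ = S ⟨T ⟨x, hx⟩, h⟩ := rfl

/-- The commutator `[S, T] = S T - T S`, on its natural domain `Dom(S T) ∩ Dom(T S)`. -/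
def commutator (S T : E →ₗ.[ℂ] E) : E →ₗ.[ℂ] E := pcomp S T - pcomp T S

/-- `(T - z)⁻¹`, with domain the range of `T - z` (when `T - z` is injective). -/
noncomputable def resolvent (T : E →ₗ.[ℂ] E) (z : ℂ) : E →ₗ.[ℂ] E :=
  ((-z) • (LinearMap.id : E →ₗ[ℂ] E) +ᵥ T).inverse

/-- The everywhere defined operator given by a bounded operator. -/
def ofBounded (B : E →L[ℂ] E) : E →ₗ.[ℂ] E := (B : E →ₗ[ℂ] E).toPMap ⊤

/-- The operator `S` is defined on all of `V`, and the bounded operator `B` agrees with it there: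
`S` extends from `V` to the bounded operator `B`. -/
def ExtendsFrom (S : E →ₗ.[ℂ] E) (V : Submodule ℂ E) (B : E →L[ℂ] E) : Prop :=
  ∀ x ∈ V, ∃ hx : x ∈ S.domain, S ⟨x, hx⟩ = B x

variable [CompleteSpace E]

/-- The operator `1 + T* T` on its natural domain. -/
noncomputable def oneAddSq (T : E →ₗ.[ℂ] E) : E →ₗ.[ℂ] E :=
  (LinearMap.id : E →ₗ[ℂ] E) +ᵥ pcomp T.adjoint T

theorem oneAddSq_inner {T : E →ₗ.[ℂ] E} (hd : Dense (T.domain : Set E))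
    (y : (oneAddSq T).domain) :
    ∃ hy : (y : E) ∈ T.domain,
      ⟪oneAddSq T y, (y : E)⟫_ℂ = ⟪(y : E), (y : E)⟫_ℂ + ⟪T ⟨y, hy⟩, T ⟨y, hy⟩⟫_ℂ := by
  obtain ⟨y, hy⟩ := y
  obtain ⟨h1, h2⟩ := mem_pcomp_domain.1 (show y ∈ (pcomp T.adjoint T).domain from hy)
  refine ⟨h1, ?_⟩
  have e : oneAddSq T ⟨y, hy⟩ = y + T.adjoint ⟨T ⟨y, h1⟩, h2⟩ := rfl
  rw [e, inner_add_left]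
  congr 1
  exact LinearPMap.adjoint_isFormalAdjoint hd ⟨T ⟨y, h1⟩, h2⟩ ⟨y, h1⟩

theorem oneAddSq_ker {T : E →ₗ.[ℂ] E} (hd : Dense (T.domain : Set E)) :
    LinearMap.ker (oneAddSq T).toFun = ⊥ := by
  rw [LinearMap.ker_eq_bot']
  intro y hy
  obtain ⟨h1, h2⟩ := oneAddSq_inner hd y
  have hy' : oneAddSq T y = 0 := hy
  rw [hy', inner_zero_left] at h2
  have h3 := congrArg Complex.re h2
  have a := inner_self_nonneg (𝕜 := ℂ) (x := (T ⟨y, h1⟩))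
  have b := inner_self_nonneg (𝕜 := ℂ) (x := (y : E))
  simp only [Complex.zero_re, Complex.add_re] at h3
  simp only [RCLike.re_to_complex] at a b
  have c : (⟪(y : E), (y : E)⟫_ℂ).re = 0 := by linarith
  exact Subtype.ext ((re_inner_self_nonpos (𝕜 := ℂ)).1 (le_of_eq c))

/-- von Neumann: for `T` closed and densely defined, `1 + T* T` has an everywhere defined bounded
inverse. -/
theorem exists_inverse_oneAddSq {T : E →ₗ.[ℂ] E} (hc : T.IsClosed)
    (hd : Dense (T.domain : Set E)) :
    ∃ R : E →L[ℂ] E, ofBounded R = (oneAddSq T).inverse := by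
  classical
  have hcl : IsClosed ((T.graph.map (WithLp.linearEquiv 2 ℂ (E × E)).symm.toLinearMap :
      Submodule ℂ (WithLp 2 (E × E))) : Set (WithLp 2 (E × E))) := by
    rw [Submodule.map_coe, LinearEquiv.coe_coe, LinearEquiv.image_eq_preimage_symm]
    exact IsClosed.preimage (WithLp.prod_continuous_ofLp 2 E E) hc
  set G : Submodule ℂ (WithLp 2 (E × E)) :=
    T.graph.map (WithLp.linearEquiv 2 ℂ (E × E)).symm.toLinearMap with hG
  have : CompleteSpace G := hcl.completeSpace_coe
  have key : ∀ x : E, ∃ y : (oneAddSq T).domain,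
      oneAddSq T y = x ∧ (G.starProjection (WithLp.toLp 2 (x, (0 : E)))).fst = y := by
    intro x
    set p := G.starProjection (WithLp.toLp 2 (x, (0 : E))) with hp
    have hpG : p ∈ G := Submodule.starProjection_apply_mem _ _
    obtain ⟨q, hq, hqp⟩ := Submodule.mem_map.1 hpG
    obtain ⟨y, hy1, hy2⟩ := (LinearPMap.mem_graph_iff _).1 hq
    have e1 : p.fst = y := by rw [← hqp, hy1]; rfl
    have e2 : p.snd = T y := by rw [← hqp, hy2]; rfl
    have horth : ∀ a : T.domain, ⟪x - (y : E), (a : E)⟫_ℂ = ⟪T y, T a⟫_ℂ := by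
      intro a
      have ha : WithLp.toLp 2 ((a : E), T a) ∈ G :=
        Submodule.mem_map.2 ⟨((a : E), T a), T.mem_graph a, rfl⟩
      have h := Submodule.starProjection_inner_eq_zero (K := G) (WithLp.toLp 2 (x, (0 : E))) _ ha
      rw [← hp, WithLp.prod_inner_apply] at h
      have f1 : (WithLp.toLp 2 (x, (0 : E)) - p).ofLp.1 = x - y := by rw [← e1]; rfl
      have f2 : (WithLp.toLp 2 (x, (0 : E)) - p).ofLp.2 = 0 - T y := by rw [← e2]; rfl
      rw [f1, f2] at h
      simp only [zero_sub, inner_neg_left] at h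
      exact add_neg_eq_zero.1 h
    have hTy : T y ∈ T.adjoint.domain :=
      LinearPMap.mem_adjoint_domain_of_exists _ ⟨x - y, horth⟩
    refine ⟨⟨y, mem_pcomp_domain.2 ⟨y.2, hTy⟩⟩, ?_, e1⟩
    have : oneAddSq T ⟨y, mem_pcomp_domain.2 ⟨y.2, hTy⟩⟩ = (y : E) + T.adjoint ⟨T y, hTy⟩ := rfl
    rw [this, LinearPMap.adjoint_apply_eq hd ⟨T y, hTy⟩ horth]
    abel
  let R : E →L[ℂ] E := (WithLp.fstL 2 ℂ E E) ∘L G.starProjection ∘L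
    (WithLp.prodContinuousLinearEquiv 2 ℂ E E).symm.toContinuousLinearMap ∘L
    ContinuousLinearMap.inl ℂ E E
  have hR : ∀ x, R x = (G.starProjection (WithLp.toLp 2 (x, (0 : E)))).fst := fun x => rfl
  have hdom : (oneAddSq T).inverse.domain = ⊤ := by
    rw [LinearPMap.inverse_domain, Submodule.eq_top_iff']
    intro x
    obtain ⟨y, hy, -⟩ := key x
    exact ⟨y, hy⟩
  refine ⟨R, LinearPMap.ext (by rw [hdom]; rfl) ?_⟩
  intro x h1 h2
  obtain ⟨y, hy, hy'⟩ := key x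
  rw [LinearPMap.inverse_apply_eq (oneAddSq_ker hd) (x := y) hy, ← hy']
  rfl

open scoped Classical in
/-- The bounded operator `(1 + T* T)⁻¹`, for `T` closed and densely defined. -/
noncomputable def invOneAddSq (T : E →ₗ.[ℂ] E) : E →L[ℂ] E :=
  if h : ∃ R : E →L[ℂ] E, ofBounded R = (oneAddSq T).inverse then h.choose else 0

theorem invOneAddSq_spec {T : E →ₗ.[ℂ] E} (hc : T.IsClosed) (hd : Dense (T.domain : Set E)) :
    ofBounded (invOneAddSq T) = (oneAddSq T).inverse := by
  have h := exists_inverse_oneAddSq hc hd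
  rw [invOneAddSq, dif_pos h]
  exact h.choose_spec

theorem invOneAddSq_nonneg {T : E →ₗ.[ℂ] E} (hc : T.IsClosed) (hd : Dense (T.domain : Set E)) :
    0 ≤ invOneAddSq T := by
  rw [ContinuousLinearMap.nonneg_iff_isPositive, ContinuousLinearMap.isPositive_iff_complex]
  intro x
  have hs := invOneAddSq_spec hc hd
  have hx : x ∈ (oneAddSq T).inverse.domain := by rw [← hs]; trivial
  have hx' := hx
  rw [LinearPMap.inverse_domain] at hx'
  obtain ⟨y, hy⟩ := hx'
  have e : invOneAddSq T x = y := by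
    rw [← LinearPMap.inverse_apply_eq (oneAddSq_ker hd) (x := y) (y := ⟨x, hx⟩) hy]
    obtain ⟨-, h⟩ := LinearPMap.ext_iff.1 hs
    exact h (x := x) (hf := trivial) (hg := hx)
  obtain ⟨h1, h2⟩ := oneAddSq_inner hd y
  have hy' : oneAddSq T y = x := hy
  rw [hy'] at h2
  have h3 : ⟪invOneAddSq T x, x⟫_ℂ = ⟪(y : E), (y : E)⟫_ℂ + ⟪T ⟨y, h1⟩, T ⟨y, h1⟩⟫_ℂ := by
    rw [e, ← inner_conj_symm, h2, map_add, inner_conj_symm, inner_conj_symm]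
  rw [h3, inner_self_eq_norm_sq_to_K, inner_self_eq_norm_sq_to_K]
  constructor
  · norm_cast
  · norm_cast
    positivity

/-- `(1 + T* T)^(-1/2)`: the positive square root of `(1 + T* T)⁻¹`. -/
noncomputable def invSqrtOneAddSq (T : E →ₗ.[ℂ] E) : E →L[ℂ] E := CFC.sqrt (invOneAddSq T)

/-- The bounded transform `F(T) = T (1 + T* T)^(-1/2)`. -/
noncomputable def boundedTransform (T : E →ₗ.[ℂ] E) : E →ₗ.[ℂ] E :=
  pcomp T (ofBounded (invSqrtOneAddSq T))

/-- A closed densely defined operator is affiliated with the von Neumann algebra `N` if each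
unitary of the commutant of `N` preserves its domain and commutes with it. -/
structure IsAffiliated (N : VonNeumannAlgebra E) (T : E →ₗ.[ℂ] E) : Prop where
  isClosed : T.IsClosed
  dense_domain : Dense (T.domain : Set E)
  commute : ∀ U ∈ unitary (E →L[ℂ] E), U ∈ N.commutant → ∀ x : T.domain,
    ∃ hx : U x ∈ T.domain, T ⟨U x, hx⟩ = U (T x)

/-- `τ`, restricted to the positive cone of `N`, is a normal semifinite faithful trace. -/
structure IsTrace (N : VonNeumannAlgebra E) (τ : (E →L[ℂ] E) → ℝ≥0∞) : Prop where
  map_add : ∀ a ∈ N, ∀ b ∈ N, 0 ≤ a → 0 ≤ b → τ (a + b) = τ a + τ b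
  map_smul : ∀ c : ℝ≥0, ∀ a ∈ N, 0 ≤ a → τ (((c : ℝ) : ℂ) • a) = c * τ a
  map_star_mul : ∀ a ∈ N, τ (star a * a) = τ (a * star a)
  faithful : ∀ a ∈ N, 0 ≤ a → τ a = 0 → a = 0
  normal : ∀ (S : Set (E →L[ℂ] E)) (a : E →L[ℂ] E), (∀ s ∈ S, s ∈ N ∧ 0 ≤ s) → S.Nonempty →
    DirectedOn (· ≤ ·) S → IsLUB S a → τ a = ⨆ s ∈ S, τ s
  semifinite : ∀ a ∈ N, 0 ≤ a → a ≠ 0 → ∃ b ∈ N, 0 ≤ b ∧ b ≠ 0 ∧ b ≤ a ∧ τ b < ∞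

/-- The `τ`-compact operators: the norm closure of `{A ∈ N | τ(|A|) < ∞}`. -/
def compacts (N : VonNeumannAlgebra E) (τ : (E →L[ℂ] E) → ℝ≥0∞) : Set (E →L[ℂ] E) :=
  closure {a | a ∈ N ∧ τ (CFC.abs a) < ∞}

/-- `(N, D, 𝒜)` is an (odd) semifinite spectral triple, with respect to the trace `τ` on `N`. -/
structure IsSemifiniteSpectralTriple (N : VonNeumannAlgebra E) (τ : (E →L[ℂ] E) → ℝ≥0∞)
    (D : E →ₗ.[ℂ] E) (𝒜 : NonUnitalStarSubalgebra ℂ (E →L[ℂ] E)) : Prop where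
  isTrace : IsTrace N τ
  isSelfAdjoint : IsSelfAdjoint D
  isAffiliated : IsAffiliated N D
  le : ∀ a ∈ 𝒜, a ∈ N
  bounded_commutator : ∀ a ∈ 𝒜, ∃ B ∈ N, ExtendsFrom (commutator D (ofBounded a)) D.domain B
  compact : ∀ a ∈ 𝒜, a * invSqrtOneAddSq D ∈ compacts N τ

/-- The multiplier algebra `M(A, N)`: the idealizer of `A` in `N`. -/
def multiplierAlgebra (A : NonUnitalStarSubalgebra ℂ (E →L[ℂ] E)) (N : VonNeumannAlgebra E) :
    StarSubalgebra ℂ (E →L[ℂ] E) where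
  carrier := {m | m ∈ N ∧ ∀ a ∈ A, m * a ∈ A ∧ a * m ∈ A}
  mul_mem' := fun {m n} hm hn => ⟨mul_mem hm.1 hn.1, fun a ha =>
    ⟨by rw [mul_assoc]; exact (hm.2 _ (hn.2 a ha).1).1,
     by rw [← mul_assoc]; exact (hn.2 _ (hm.2 a ha).2).2⟩⟩
  add_mem' := fun {m n} hm hn => ⟨add_mem hm.1 hn.1, fun a ha =>
    ⟨by rw [add_mul]; exact add_mem (hm.2 a ha).1 (hn.2 a ha).1,
     by rw [mul_add]; exact add_mem (hm.2 a ha).2 (hn.2 a ha).2⟩⟩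
  algebraMap_mem' := fun c => ⟨N.toStarSubalgebra.algebraMap_mem c, fun a ha =>
    ⟨by rw [← Algebra.smul_def]; exact A.smul_mem c ha,
     by rw [← Algebra.commutes, ← Algebra.smul_def]; exact A.smul_mem c ha⟩⟩
  star_mem' := fun {m} hm => ⟨star_mem hm.1, fun a ha =>
    ⟨by simpa using star_mem (hm.2 _ (star_mem ha)).2,
     by simpa using star_mem (hm.2 _ (star_mem ha)).1⟩⟩

/-- A (possibly unbounded) `A`-multiplier: a closed operator `T` affiliated with `N` whose bounded
transform lies in `M(A, N)` and for which `(1 + T* T)^(-1/2) A` is a dense subset of `A`. -/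
structure IsUnboundedMultiplier (A : NonUnitalStarSubalgebra ℂ (E →L[ℂ] E))
    (N : VonNeumannAlgebra E) (T : E →ₗ.[ℂ] E) : Prop where
  isAffiliated : IsAffiliated N T
  boundedTransform_mem : ∃ m ∈ multiplierAlgebra A N, boundedTransform T = ofBounded m
  mul_mem : ∀ a ∈ A, invSqrtOneAddSq T * a ∈ A
  dense : ∀ a ∈ A, a ∈ closure {b | ∃ c ∈ A, b = invSqrtOneAddSq T * c}

/-- The conditions in the definition of `D`-differentiability of `H`, for a given core `V`
of `D`. -/
structure IsDifferentiableOnCore (N : VonNeumannAlgebra E) (D H : E →ₗ.[ℂ] E)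
    (V : Submodule ℂ E) : Prop where
  hasCore : D.HasCore V
  resolvent_mem : ∀ μ : ℝ, μ ≠ 0 → ∀ x ∈ V,
    ∃ hx : x ∈ (resolvent H (Complex.I * μ)).domain,
      resolvent H (Complex.I * μ) ⟨x, hx⟩ ∈ H.domain ∧
      ∃ hD : resolvent H (Complex.I * μ) ⟨x, hx⟩ ∈ D.domain,
        D ⟨resolvent H (Complex.I * μ) ⟨x, hx⟩, hD⟩ ∈ H.domain
  bounded : ∀ μ : ℝ, μ ≠ 0 → ∃ C ∈ N,
    ExtendsFrom (pcomp (commutator D H) (resolvent H (Complex.I * μ))) V C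

/-- `H` is a self-adjoint operator affiliated with `N` that is `D`-differentiable. -/
structure IsDifferentiable (N : VonNeumannAlgebra E) (D H : E →ₗ.[ℂ] E) : Prop where
  isSelfAdjoint : IsSelfAdjoint H
  isAffiliated : IsAffiliated N H
  exists_core : ∃ V : Submodule ℂ E, IsDifferentiableOnCore N D H V

end Operators

end Callias

/-!
Write `r z = (H - z)⁻¹`, and let `C` be the bounded extension of `[D, H] (H + i)⁻¹`, so that
`[D, r (-i)] = - r (-i) C`. Since `D` and `H` are self-adjoint, comparing this with its adjoint
shows that `B = r i C` is skew-adjoint. With `c μ = (H + i) (H - iμ)⁻¹`, resolvent calculus gives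
`[D, r (iμ)] = - (c (-μ))* B (c μ)`.

Let `S = (1 + H²)^(-1/2)`. Since `‖r (-i) x‖ = ‖S x‖`, one can write `iB = S A` with `‖A‖ ≤ ‖C‖`;
as `S A` is self-adjoint, Reid's inequality yields
`|⟪B x, y⟫| ≤ ‖C‖ ‖S^(1/2) x‖ ‖S^(1/2) y‖`.

Riemann sums of `(2/π) ∫ (cos² θ + t sin² θ)⁻¹ dθ = t^(-1/2)` over `(0, π/2)`, taken at the left
endpoints of a uniform partition, converge to `t^(-1/2)` from below for `0 < t ≤ 1`. At
`t = (1 + H²)⁻¹` they exhibit `F(H)` as a strong limit of sums `∑ w μ (r (iμ) + r (-iμ)) / 2` for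
which `∑ w μ S (c μ)* (c μ) ≤ 1`. By Cauchy–Schwarz the commutators of these sums with `D` are
bounded in norm by `‖C‖`, and this bound passes to the limit because `D` is closed.
-/

namespace Callias

section Resolvent

/-- The map `T - z` on the domain of `T`. -/
def subSmul {E : Type*} [NormedAddCommGroup E] [InnerProductSpace ℂ E] (T : E →ₗ.[ℂ] E) (z : ℂ) :
    T.domain →ₗ[ℂ] E :=
  T.toFun - z • T.domain.subtype

theorem subSmul_apply {E : Type*} [NormedAddCommGroup E] [InnerProductSpace ℂ E]
    (T : E →ₗ.[ℂ] E) (z : ℂ) (x : T.domain) : subSmul T z x = T x - z • (x : E) :=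
  rfl

theorem resolvent_eq_inverse_subSmul {E : Type*} [NormedAddCommGroup E] [InnerProductSpace ℂ E]
    (T : E →ₗ.[ℂ] E) (z : ℂ) :
    resolvent T z = (⟨T.domain, subSmul T z⟩ : E →ₗ.[ℂ] E).inverse := by
  refine congrArg LinearPMap.inverse (LinearPMap.ext rfl fun {x} _ hx => ?_)
  change (-z) • x + T ⟨x, hx⟩ = T ⟨x, hx⟩ - z • x
  rw [neg_smul, neg_add_eq_sub]

variable {E : Type*} [NormedAddCommGroup E] [InnerProductSpace ℂ E] [CompleteSpace E]
  {H : E →ₗ.[ℂ] E} {z w : ℂ} {x y : E}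

theorem inner_map_comm (hH : IsSelfAdjoint H) (x y : H.domain) :
    ⟪H x, (y : E)⟫_ℂ = ⟪(x : E), H y⟫_ℂ := by
  have h := LinearPMap.adjoint_isFormalAdjoint hH.dense_domain
  rw [LinearPMap.isSelfAdjoint_def.1 hH] at h
  exact h x y

theorem exists_map_eq_of_inner (hH : IsSelfAdjoint H)
    (h : ∀ u : H.domain, ⟪y, (u : E)⟫_ℂ = ⟪x, H u⟫_ℂ) :
    ∃ hx : x ∈ H.domain, H ⟨x, hx⟩ = y := by
  have hmem : x ∈ H.adjoint.domain := LinearPMap.mem_adjoint_domain_of_exists _ ⟨y, h⟩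
  have happly := LinearPMap.adjoint_apply_eq hH.dense_domain ⟨x, hmem⟩ h
  obtain ⟨hdom, heq⟩ := LinearPMap.ext_iff.1 (LinearPMap.isSelfAdjoint_def.1 hH)
  exact ⟨hdom ▸ hmem, (heq (hf := hmem)).symm.trans happly⟩

theorem exists_norm_map_sub_le (hH : IsSelfAdjoint H) {c : ℝ} (hc : 0 ≤ c) {u v : E}
    (h : ∀ y : H.domain, ‖⟪v, (y : E)⟫_ℂ - ⟪u, H y⟫_ℂ‖ ≤ c * ‖(y : E)‖) :
    ∃ hu : u ∈ H.domain, ‖H ⟨u, hu⟩ - v‖ ≤ c := by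
  let f : H.domain →ₗ[ℂ] ℂ :=
    (innerSL ℂ v).toLinearMap ∘ₗ H.domain.subtype - (innerSL ℂ u).toLinearMap ∘ₗ H.toFun
  have hdense : DenseRange H.domain.subtype := by
    simpa [DenseRange] using hH.dense_domain
  let w := (InnerProductSpace.toDual ℂ E).symm (f.extendOfNorm H.domain.subtype)
  have hw : ∀ y : H.domain, ⟪w, (y : E)⟫_ℂ = ⟪v, (y : E)⟫_ℂ - ⟪u, H y⟫_ℂ := fun y => by
    rw [InnerProductSpace.toDual_symm_apply]
    exact f.extendOfNorm_eq hdense ⟨c, h⟩ y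
  obtain ⟨hu, hHu⟩ : ∃ hu : u ∈ H.domain, H ⟨u, hu⟩ = v - w :=
    exists_map_eq_of_inner hH fun y => by rw [inner_sub_left, hw, sub_sub_cancel]
  refine ⟨hu, ?_⟩
  rw [hHu, sub_sub_cancel_left, norm_neg, LinearIsometryEquiv.norm_map]
  exact LinearMap.opNorm_extendOfNorm_le hdense hc h

theorem abs_im_mul_norm_le_norm_subSmul (hH : IsSelfAdjoint H) (z : ℂ) (x : H.domain) :
    |z.im| * ‖(x : E)‖ ≤ ‖subSmul H z x‖ := by
  rcases (norm_nonneg (x : E)).eq_or_lt with hx | hx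
  · rw [← hx, mul_zero]
    exact norm_nonneg _
  have hreal : (⟪(x : E), H x⟫_ℂ).im = 0 := by
    rw [← Complex.conj_eq_iff_im, inner_conj_symm, inner_map_comm hH]
  have him : (⟪(x : E), subSmul H z x⟫_ℂ).im = -(z.im * ‖(x : E)‖ ^ 2) := by
    rw [subSmul_apply, inner_sub_right, inner_smul_right, inner_self_eq_norm_sq_to_K,
      Complex.sub_im, hreal, zero_sub]
    norm_cast
    exact congrArg _ (Complex.im_mul_ofReal _ _)
  refine le_of_mul_le_mul_right ?_ hx
  calc |z.im| * ‖(x : E)‖ * ‖(x : E)‖ = |(⟪(x : E), subSmul H z x⟫_ℂ).im| := by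
        rw [him, abs_neg, abs_mul, abs_pow, abs_norm]; ring
    _ ≤ ‖⟪(x : E), subSmul H z x⟫_ℂ‖ := Complex.abs_im_le_norm _
    _ ≤ ‖subSmul H z x‖ * ‖(x : E)‖ := by
        rw [mul_comm]; exact norm_inner_le_norm _ _

theorem ker_subSmul (hH : IsSelfAdjoint H) (hz : z.im ≠ 0) :
    LinearMap.ker (subSmul H z) = ⊥ := by
  refine LinearMap.ker_eq_bot'.2 fun x hx => Subtype.ext ?_
  have hle := abs_im_mul_norm_le_norm_subSmul hH z x
  rw [show subSmul H z x = 0 from hx, norm_zero] at hle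
  exact norm_le_zero_iff.1 (nonpos_of_mul_nonpos_right hle (abs_pos.2 hz))

theorem isClosed_range_subSmul (hH : IsSelfAdjoint H) (hz : z.im ≠ 0) :
    IsClosed (LinearMap.range (subSmul H z) : Set E) := by
  have hgraph : IsClosed (H.graph : Set (E × E)) := hH.isClosed
  have : CompleteSpace H.graph := hgraph.completeSpace_coe
  let f : H.graph →L[ℂ] E :=
    (ContinuousLinearMap.snd ℂ E E - z • ContinuousLinearMap.fst ℂ E E) ∘L H.graph.subtypeL
  have hf : AntilipschitzWith (Real.toNNReal (1 + (‖z‖ + 1) * |z.im|⁻¹)) f := by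
    refine f.antilipschitz_of_bound fun p => ?_
    obtain ⟨x, hx, hHx⟩ := (LinearPMap.mem_graph_iff _).1 p.2
    have hfp : f p = subSmul H z x := by
      rw [subSmul_apply, hx, hHx]; rfl
    have hfst : ‖(p : E × E).1‖ ≤ |z.im|⁻¹ * ‖f p‖ := by
      rw [← hx, hfp, le_inv_mul_iff₀ (abs_pos.2 hz)]
      exact abs_im_mul_norm_le_norm_subSmul hH z x
    have hsnd : ‖(p : E × E).2‖ ≤ ‖f p‖ + ‖z‖ * ‖(p : E × E).1‖ := by
      rw [← norm_smul]
      simpa [f] using norm_add_le (f p) (z • (p : E × E).1)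
    have hnonneg : 0 ≤ |z.im|⁻¹ * ‖f p‖ := by positivity
    rw [Real.coe_toNNReal _ (by positivity), Submodule.coe_norm, Prod.norm_def]
    refine max_le ?_ ?_ <;>
      nlinarith [norm_nonneg z, norm_nonneg (f p),
        mul_le_mul_of_nonneg_left hfst (norm_nonneg z), mul_nonneg (norm_nonneg z) hnonneg]
  convert hf.isClosed_range f.uniformContinuous using 1
  ext y
  constructor
  · rintro ⟨x, rfl⟩
    exact ⟨⟨_, H.mem_graph x⟩, (subSmul_apply H z x).symm⟩
  · rintro ⟨⟨p, hp⟩, rfl⟩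
    obtain ⟨x, hx, hHx⟩ := (LinearPMap.mem_graph_iff _).1 hp
    refine ⟨x, (subSmul_apply H z x).trans ?_⟩
    rw [hx, hHx]; rfl

theorem range_subSmul (hH : IsSelfAdjoint H) (hz : z.im ≠ 0) :
    LinearMap.range (subSmul H z) = ⊤ := by
  have : CompleteSpace (LinearMap.range (subSmul H z)) :=
    (isClosed_range_subSmul hH hz).completeSpace_coe
  rw [← Submodule.orthogonal_eq_bot_iff, Submodule.eq_bot_iff]
  intro y hy
  obtain ⟨hmem, hHy⟩ : ∃ hy : y ∈ H.domain, H ⟨y, hy⟩ = (starRingEnd ℂ) z • y := by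
    refine exists_map_eq_of_inner hH fun u => ?_
    have horth : ⟪y, subSmul H z u⟫_ℂ = 0 := (Submodule.mem_orthogonal' _ _).1 hy _ ⟨u, rfl⟩
    rw [subSmul_apply, inner_sub_right, inner_smul_right, sub_eq_zero] at horth
    rw [horth, inner_smul_left, Complex.conj_conj]
  have hle := abs_im_mul_norm_le_norm_subSmul hH ((starRingEnd ℂ) z) ⟨y, hmem⟩
  rw [subSmul_apply, hHy, sub_self, norm_zero, Complex.conj_im, abs_neg] at hle
  exact norm_le_zero_iff.1 (nonpos_of_mul_nonpos_right hle (abs_pos.2 hz))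

theorem exists_ofBounded_eq_resolvent (hH : IsSelfAdjoint H) (hz : z.im ≠ 0) :
    ∃ R : E →L[ℂ] E, ofBounded R = resolvent H z := by
  let e : H.domain ≃ₗ[ℂ] E := LinearEquiv.ofBijective (subSmul H z)
    ⟨LinearMap.ker_eq_bot.1 (ker_subSmul hH hz), LinearMap.range_eq_top.1 (range_subSmul hH hz)⟩
  have he : ∀ x, subSmul H z (e.symm x) = x := e.apply_symm_apply
  have hdom : (⟨H.domain, subSmul H z⟩ : E →ₗ.[ℂ] E).inverse.domain = ⊤ :=
    LinearPMap.inverse_domain.trans (range_subSmul hH hz)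
  rw [resolvent_eq_inverse_subSmul]
  refine ⟨(H.domain.subtype ∘ₗ e.symm.toLinearMap).mkContinuous |z.im|⁻¹ fun x => ?_,
    LinearPMap.ext hdom.symm fun {x} _ hx => ?_⟩
  · rw [le_inv_mul_iff₀ (abs_pos.2 hz)]
    exact (abs_im_mul_norm_le_norm_subSmul hH z (e.symm x)).trans_eq (congrArg _ (he x))
  · exact (LinearPMap.inverse_apply_eq (ker_subSmul hH hz) (y := ⟨x, hx⟩) (he x)).symm

open scoped Classical in
/-- The resolvent `(H - z)⁻¹` as a bounded operator; it is meant for `z` off the spectrum of `H`,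
and is `0` when the resolvent is not bounded and everywhere defined. -/
noncomputable def resolventCLM (H : E →ₗ.[ℂ] E) (z : ℂ) : E →L[ℂ] E :=
  if h : ∃ R : E →L[ℂ] E, ofBounded R = resolvent H z then h.choose else 0

theorem ofBounded_resolventCLM (hH : IsSelfAdjoint H) (hz : z.im ≠ 0) :
    ofBounded (resolventCLM H z) = resolvent H z := by
  have h := exists_ofBounded_eq_resolvent hH hz
  rw [resolventCLM, dif_pos h]
  exact h.choose_spec

theorem resolventCLM_subSmul (hH : IsSelfAdjoint H) (hz : z.im ≠ 0) (u : H.domain) :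
    resolventCLM H z (subSmul H z u) = u := by
  obtain ⟨hdom, heq⟩ := LinearPMap.ext_iff.1
    ((ofBounded_resolventCLM hH hz).trans (resolvent_eq_inverse_subSmul H z))
  exact (heq (hf := trivial) (hg := hdom.le trivial)).trans
    (LinearPMap.inverse_apply_eq (ker_subSmul hH hz) rfl)

theorem resolventCLM_eq_iff (hH : IsSelfAdjoint H) (hz : z.im ≠ 0) :
    resolventCLM H z x = y ↔ ∃ hy : y ∈ H.domain, H ⟨y, hy⟩ = x + z • y := by
  constructor
  · rintro rfl
    obtain ⟨u, rfl⟩ := LinearMap.range_eq_top.1 (range_subSmul hH hz) x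
    rw [resolventCLM_subSmul hH hz]
    exact ⟨u.2, by rw [subSmul_apply, sub_add_cancel]⟩
  · rintro ⟨hy, hHy⟩
    have h := resolventCLM_subSmul hH hz ⟨y, hy⟩
    rwa [subSmul_apply, hHy, add_sub_cancel_right] at h

theorem resolventCLM_spec (hH : IsSelfAdjoint H) (hz : z.im ≠ 0) (x : E) :
    ∃ hx : resolventCLM H z x ∈ H.domain,
      H ⟨resolventCLM H z x, hx⟩ = x + z • resolventCLM H z x :=
  (resolventCLM_eq_iff hH hz).1 rfl

theorem norm_resolventCLM_le (hH : IsSelfAdjoint H) (hz : z.im ≠ 0) :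
    ‖resolventCLM H z‖ ≤ |z.im|⁻¹ := by
  refine ContinuousLinearMap.opNorm_le_bound _ (by positivity) fun x => ?_
  obtain ⟨hmem, heq⟩ := resolventCLM_spec hH hz x
  have hle := abs_im_mul_norm_le_norm_subSmul hH z ⟨_, hmem⟩
  rwa [subSmul_apply, heq, add_sub_cancel_right, ← le_inv_mul_iff₀ (abs_pos.2 hz)] at hle

theorem star_resolventCLM (hH : IsSelfAdjoint H) (hz : z.im ≠ 0) :
    star (resolventCLM H z) = resolventCLM H (star z) := by
  rw [ContinuousLinearMap.star_eq_adjoint, eq_comm, ContinuousLinearMap.eq_adjoint_iff]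
  intro x y
  obtain ⟨hx, hHx⟩ := resolventCLM_spec hH (z := star z) (by simpa using hz) x
  obtain ⟨hy, hHy⟩ := resolventCLM_spec hH hz y
  have h := inner_map_comm hH ⟨_, hx⟩ ⟨_, hy⟩
  rw [hHx, hHy, inner_add_left, inner_add_right, inner_smul_left, inner_smul_right,
    ← Complex.star_def, star_star] at h
  exact (add_right_cancel h).symm

theorem resolventCLM_sub (hH : IsSelfAdjoint H) (hz : z.im ≠ 0) (hw : w.im ≠ 0) :
    resolventCLM H z - resolventCLM H w = (z - w) • (resolventCLM H z * resolventCLM H w) := by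
  ext x
  obtain ⟨hx, hHx⟩ := resolventCLM_spec hH hw x
  have h : resolventCLM H z (x + (w - z) • resolventCLM H w x) = resolventCLM H w x :=
    (resolventCLM_eq_iff hH hz).2 ⟨hx, by rw [hHx]; module⟩
  rw [map_add, map_smul] at h
  simp only [sub_apply, smul_apply, mul_apply_eq_comp]
  linear_combination (norm := module) h

theorem commute_resolventCLM (hH : IsSelfAdjoint H) (hz : z.im ≠ 0) (hw : w.im ≠ 0) :
    Commute (resolventCLM H z) (resolventCLM H w) := by
  rcases eq_or_ne z w with rfl | hne
  · exact Commute.refl _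
  have h : (z - w) • (resolventCLM H z * resolventCLM H w - resolventCLM H w * resolventCLM H z) =
      0 := by
    rw [smul_sub, ← resolventCLM_sub hH hz hw, ← neg_sub w z, neg_smul, ← resolventCLM_sub hH hw hz]
    abel
  exact sub_eq_zero.1 ((smul_eq_zero.1 h).resolve_left (sub_ne_zero.2 hne))

end Resolvent

section Affiliated

theorem mem_span_unitary_of_isClosed {A : Type*} [CStarAlgebra A] {S : StarSubalgebra ℂ A}
    (hS : IsClosed (S : Set A)) {a : A} (ha : a ∈ S) :
    a ∈ Submodule.span ℂ {u : A | u ∈ unitary A ∧ u ∈ S} := by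
  have : IsClosed (S : Set A) := hS
  have hspan : (⟨a, ha⟩ : S) ∈ Submodule.span ℂ (unitary S : Set S) :=
    CStarAlgebra.span_unitary S ▸ Submodule.mem_top
  have hmap := Submodule.mem_map_of_mem (f := S.subtype.toAlgHom.toLinearMap) hspan
  rw [Submodule.map_span] at hmap
  refine Submodule.span_mono ?_ hmap
  rintro _ ⟨u, hu, rfl⟩
  exact ⟨Unitary.map_mem S.subtype hu, u.2⟩

variable {E : Type*} [NormedAddCommGroup E] [InnerProductSpace ℂ E] [CompleteSpace E]
  {N : VonNeumannAlgebra E} {H : E →ₗ.[ℂ] E} {z : ℂ}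

theorem mem_of_forall_unitary_commute {a : E →L[ℂ] E}
    (ha : ∀ U ∈ unitary (E →L[ℂ] E), U ∈ N.commutant → Commute a U) : a ∈ N := by
  rw [← VonNeumannAlgebra.commutant_commutant N, VonNeumannAlgebra.mem_commutant_iff]
  intro T hT
  have hclosed : IsClosed (N.commutant.toStarSubalgebra : Set (E →L[ℂ] E)) := by
    rw [VonNeumannAlgebra.coe_toStarSubalgebra, VonNeumannAlgebra.coe_commutant]
    exact Set.isClosed_centralizer _
  have hspan := mem_span_unitary_of_isClosed hclosed hT
  clear hT
  induction hspan using Submodule.span_induction with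
  | mem U hU => exact (ha U hU.1 hU.2).symm
  | zero => exact Commute.zero_left a
  | add S T _ _ hS hT => exact Commute.add_left hS hT
  | smul c T _ hT => exact Commute.smul_left hT c

theorem IsAffiliated.resolventCLM_mem (hN : IsAffiliated N H) (hH : IsSelfAdjoint H)
    (hz : z.im ≠ 0) : resolventCLM H z ∈ N := by
  refine mem_of_forall_unitary_commute fun U hU hUN => ContinuousLinearMap.ext fun x => ?_
  obtain ⟨hx, hHx⟩ := resolventCLM_spec hH hz x
  obtain ⟨hUx, hHUx⟩ := hN.commute U hU hUN ⟨_, hx⟩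
  exact (resolventCLM_eq_iff hH hz).2 ⟨hUx, hHUx.trans (by rw [hHx, map_add, map_smul]; rfl)⟩

end Affiliated

section BoundedCommutator

/-- The bounded operator `a` preserves `Dom D`, and `[D, a]` agrees with the bounded operator `K`
on `Dom D`. -/
def HasCommutator {E : Type*} [NormedAddCommGroup E] [InnerProductSpace ℂ E] (D : E →ₗ.[ℂ] E)
    (a K : E →L[ℂ] E) : Prop :=
  ∀ x : D.domain, ∃ hx : a x ∈ D.domain, D ⟨a x, hx⟩ = a (D x) + K x

namespace HasCommutator

variable {E : Type*} [NormedAddCommGroup E] [InnerProductSpace ℂ E]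
  {D : E →ₗ.[ℂ] E} {a b q K L : E →L[ℂ] E}

theorem one : HasCommutator D 1 0 := fun x => ⟨x.2, by simp⟩

theorem zero : HasCommutator D 0 0 := fun x => by
  refine ⟨D.domain.zero_mem, D.map_zero.trans ?_⟩
  simp

theorem add (ha : HasCommutator D a K) (hb : HasCommutator D b L) :
    HasCommutator D (a + b) (K + L) := fun x => by
  obtain ⟨hax, hDa⟩ := ha x
  obtain ⟨hbx, hDb⟩ := hb x
  refine ⟨D.domain.add_mem hax hbx, (D.map_add ⟨_, hax⟩ ⟨_, hbx⟩).trans ?_⟩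
  rw [hDa, hDb]
  exact add_add_add_comm _ _ _ _

theorem smul (ha : HasCommutator D a K) (c : ℂ) : HasCommutator D (c • a) (c • K) := fun x => by
  obtain ⟨hax, hDa⟩ := ha x
  refine ⟨D.domain.smul_mem c hax, (D.map_smul c ⟨_, hax⟩).trans ?_⟩
  rw [hDa]
  exact smul_add _ _ _

theorem sub (ha : HasCommutator D a K) (hb : HasCommutator D b L) :
    HasCommutator D (a - b) (K - L) := by
  simpa [sub_eq_add_neg] using ha.add (hb.smul (-1))

theorem sum {ι : Type*} {s : Finset ι} {a K : ι → E →L[ℂ] E}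
    (h : ∀ i ∈ s, HasCommutator D (a i) (K i)) :
    HasCommutator D (∑ i ∈ s, a i) (∑ i ∈ s, K i) := by
  classical
  induction s using Finset.induction_on with
  | empty => exact zero
  | insert i s hi ih =>
    rw [Finset.sum_insert hi, Finset.sum_insert hi]
    exact (h i (s.mem_insert_self i)).add (ih fun j hj => h j (Finset.mem_insert_of_mem hj))

theorem unique (hdense : Dense (D.domain : Set E)) (hK : HasCommutator D a K)
    (hL : HasCommutator D a L) : K = L := by
  refine DFunLike.coe_injective (Continuous.ext_on hdense K.continuous L.continuous fun x hx => ?_)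
  obtain ⟨_, hDK⟩ := hK ⟨x, hx⟩
  obtain ⟨_, hDL⟩ := hL ⟨x, hx⟩
  exact add_left_cancel (hDK.symm.trans hDL)

theorem extendsFrom (ha : HasCommutator D a K) :
    ExtendsFrom (commutator D (ofBounded a)) D.domain K := fun x hx => by
  obtain ⟨hax, hDa⟩ := ha ⟨x, hx⟩
  exact ⟨⟨mem_pcomp_domain.2 ⟨trivial, hax⟩, mem_pcomp_domain.2 ⟨hx, trivial⟩⟩,
    sub_eq_iff_eq_add'.2 hDa⟩

theorem of_core {V : Submodule ℂ E} (hclosed : D.IsClosed) (hV : D.HasCore V)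
    (h : ∀ x (hx : x ∈ V), ∃ h : a x ∈ D.domain, D ⟨a x, h⟩ = a (D ⟨x, hV.le_domain hx⟩) + K x) :
    HasCommutator D a K := by
  intro x
  have hcore : (D.domRestrict V).graph.topologicalClosure = D.graph := by
    rw [LinearPMap.IsClosable.graph_closure_eq_closure_graph, hV.closure_eq]
    exact hclosed.isClosable.leIsClosable LinearPMap.domRestrict_le
  let Φ : E × E → E × E := fun p => (a p.1, a p.2 + K p.1)
  have hmaps : Set.MapsTo Φ ((D.domRestrict V).graph : Set (E × E)) (D.graph : Set (E × E)) := by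
    intro p hp
    obtain ⟨u, rfl⟩ := (LinearPMap.mem_graph_iff' _).1 hp
    obtain ⟨hau, hDau⟩ := h u u.2.1
    exact (LinearPMap.mem_graph_iff _).2 ⟨⟨a u, hau⟩, rfl, hDau⟩
  have hx : ((x : E), D x) ∈ (D.domRestrict V).graph.topologicalClosure := hcore ▸ D.mem_graph x
  have hΦx : Φ (x, D x) ∈ closure (D.graph : Set (E × E)) :=
    hmaps.closure (by fun_prop) hx
  rw [IsClosed.closure_eq hclosed] at hΦx
  obtain ⟨⟨_, hax⟩, rfl, hDa⟩ := (LinearPMap.mem_graph_iff _).1 hΦx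
  exact ⟨hax, hDa⟩

variable [CompleteSpace E]

theorem star (hD : IsSelfAdjoint D) (ha : HasCommutator D a K) :
    HasCommutator D (star a) (-star K) := fun x => by
  refine exists_map_eq_of_inner hD fun y => ?_
  obtain ⟨hay, hDa⟩ := ha y
  have h := inner_map_comm hD x ⟨_, hay⟩
  rw [hDa, inner_add_right] at h
  simp only [ContinuousLinearMap.star_eq_adjoint, neg_apply, inner_add_left,
    inner_neg_left, ContinuousLinearMap.adjoint_inner_left] at h ⊢
  rw [h, add_neg_cancel_right]

theorem mem {N : VonNeumannAlgebra E} (hN : IsAffiliated N D) (haN : a ∈ N)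
    (ha : HasCommutator D a K) : K ∈ N := by
  refine mem_of_forall_unitary_commute fun U hU hUN => DFunLike.coe_injective
    (Continuous.ext_on hN.dense_domain (K * U).continuous (U * K).continuous fun x hx => ?_)
  have hcomm : ∀ y, a (U y) = U (a y) := fun y =>
    DFunLike.congr_fun (VonNeumannAlgebra.mem_commutant_iff.1 hUN a haN) y
  obtain ⟨hax, hDa⟩ := ha ⟨x, hx⟩
  obtain ⟨hUx, hDU⟩ := hN.commute U hU hUN ⟨x, hx⟩
  obtain ⟨haUx, hDaU⟩ := ha ⟨_, hUx⟩
  obtain ⟨hUax, hDUa⟩ := hN.commute U hU hUN ⟨_, hax⟩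
  have heq : D ⟨a (U x), haUx⟩ = D ⟨U (a x), hUax⟩ := congrArg D (Subtype.ext (hcomm x))
  refine add_left_cancel (a := a (U (D ⟨x, hx⟩))) ?_
  calc a (U (D ⟨x, hx⟩)) + K (U x) = D ⟨a (U x), haUx⟩ := by rw [← hDU]; exact hDaU.symm
    _ = U (a (D ⟨x, hx⟩) + K x) := by rw [heq, ← hDa]; exact hDUa
    _ = a (U (D ⟨x, hx⟩)) + U (K x) := by rw [map_add, hcomm]

theorem mem_domain_of_mul_eq_one (hD : IsSelfAdjoint D) (ha : HasCommutator D a K)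
    (haq : a * q = 1) (hqa : q * a = 1) (x : D.domain) : q x ∈ D.domain := by
  set z : ℂ := ((‖q * K‖ + 1 : ℝ) : ℂ) * Complex.I with hz
  have him : z.im = ‖q * K‖ + 1 := by simp [hz]
  have hz0 : z.im ≠ 0 := by rw [him]; positivity
  set r := resolventCLM D z
  have hsmall : ‖-(q * K * r)‖ < 1 := by
    rw [norm_neg]
    refine (norm_mul_le _ _).trans_lt ((mul_le_mul_of_nonneg_left
      (norm_resolventCLM_le hD hz0) (norm_nonneg _)).trans_lt ?_)
    rw [him, abs_of_pos (by positivity), mul_inv_lt_iff₀ (by positivity)]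
    linarith
  obtain ⟨u, hu⟩ := isUnit_one_sub_of_norm_lt_one hsmall
  rw [sub_neg_eq_add] at hu
  obtain ⟨y, hy⟩ : ∃ y, y + q (K (r y)) = q (subSmul D z x) :=
    ⟨(↑u⁻¹ : E →L[ℂ] E) (q (subSmul D z x)), by
      simpa [hu] using DFunLike.congr_fun u.mul_inv (q (subSmul D z x))⟩
  obtain ⟨hry, hDry⟩ := resolventCLM_spec hD hz0 y
  obtain ⟨hary, hDary⟩ := ha ⟨_, hry⟩
  have heq : subSmul D z ⟨a (r y), hary⟩ = subSmul D z x := by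
    have haqx : ∀ v, a (q v) = v := DFunLike.congr_fun haq
    have hay := congrArg a hy
    rw [map_add, haqx, haqx] at hay
    rw [← hay, subSmul_apply, hDary, hDry, map_add, map_smul]
    abel
  have hqx : q x = r y := by
    rw [← LinearMap.ker_eq_bot.1 (ker_subSmul hD hz0) heq]
    exact DFunLike.congr_fun hqa (r y)
  exact hqx ▸ hry

theorem inv (hD : IsSelfAdjoint D) (ha : HasCommutator D a K) (haq : a * q = 1)
    (hqa : q * a = 1) : HasCommutator D q (-(q * K * q)) := by
  intro x
  have hqx := mem_domain_of_mul_eq_one hD ha haq hqa x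
  refine ⟨hqx, ?_⟩
  obtain ⟨haqx, hDaq⟩ := ha ⟨_, hqx⟩
  have hx : (⟨a (q x), haqx⟩ : D.domain) = x := Subtype.ext (DFunLike.congr_fun haq (x : E))
  have hDq : q (a (D ⟨q x, hqx⟩)) = D ⟨q x, hqx⟩ := DFunLike.congr_fun hqa _
  rw [← hDq, eq_sub_of_add_eq (hDaq.symm.trans (congrArg D hx)), map_sub]
  exact sub_eq_add_neg _ _

theorem exists_of_norm_inner_sub_inner_le (hD : IsSelfAdjoint D) {c : ℝ} (hc : 0 ≤ c)
    (h : ∀ x y : D.domain, ‖⟪a (D x), (y : E)⟫_ℂ - ⟪a x, D y⟫_ℂ‖ ≤ c * ‖(x : E)‖ * ‖(y : E)‖) :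
    ∃ K, HasCommutator D a K ∧ ‖K‖ ≤ c := by
  choose hmem hle using fun x : D.domain =>
    exists_norm_map_sub_le hD (by positivity) (h x)
  let k : D.domain →ₗ[ℂ] E :=
    D.toFun ∘ₗ (a.toLinearMap ∘ₗ D.domain.subtype).codRestrict D.domain hmem -
      a.toLinearMap ∘ₗ D.toFun
  have hdense : DenseRange D.domain.subtype := by
    simpa [DenseRange] using hD.dense_domain
  refine ⟨k.extendOfNorm D.domain.subtype, fun x => ⟨hmem x, ?_⟩,
    LinearMap.opNorm_extendOfNorm_le hdense hc hle⟩
  exact sub_eq_iff_eq_add'.1 (k.extendOfNorm_eq hdense ⟨c, hle⟩ x).symm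

theorem exists_of_tendsto (hD : IsSelfAdjoint D) {c : ℝ} (hc : 0 ≤ c) {A K : ℕ → E →L[ℂ] E}
    (hA : ∀ n, HasCommutator D (A n) (K n))
    (hK : ∀ n x y, ‖⟪K n x, y⟫_ℂ‖ ≤ c * ‖x‖ * ‖y‖)
    (hlim : ∀ x, Filter.Tendsto (fun n => A n x) Filter.atTop (nhds (a x))) :
    ∃ L, HasCommutator D a L ∧ ‖L‖ ≤ c := by
  refine exists_of_norm_inner_sub_inner_le hD hc fun x y => ?_
  have hform : ∀ n, ⟪A n (D x), (y : E)⟫_ℂ - ⟪A n x, D y⟫_ℂ = -⟪K n x, (y : E)⟫_ℂ := fun n => by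
    obtain ⟨hx, hDx⟩ := hA n x
    rw [← inner_map_comm hD ⟨_, hx⟩ y, hDx, inner_add_left, sub_add_cancel_left]
  have htendsto : Filter.Tendsto (fun n => ‖⟪A n (D x), (y : E)⟫_ℂ - ⟪A n x, D y⟫_ℂ‖) Filter.atTop
      (nhds ‖⟪a (D x), (y : E)⟫_ℂ - ⟪a x, D y⟫_ℂ‖) :=
    (((hlim _).inner tendsto_const_nhds).sub ((hlim _).inner tendsto_const_nhds)).norm
  refine le_of_tendsto htendsto (Filter.Eventually.of_forall fun n => ?_)
  rw [hform, norm_neg]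
  exact hK n x y

end HasCommutator

end BoundedCommutator

section ResolventCommutator

variable {E : Type*} [NormedAddCommGroup E] [InnerProductSpace ℂ E] [CompleteSpace E]
  {D H : E →ₗ.[ℂ] E} {C K : E →L[ℂ] E} {z w : ℂ}

theorem hasCommutator_resolventCLM_of_extendsFrom {V : Submodule ℂ E} (hD : D.IsClosed)
    (hV : D.HasCore V) (hH : IsSelfAdjoint H) (hz : z.im ≠ 0)
    (hC : ExtendsFrom (pcomp (commutator D H) (resolvent H z)) V C) :
    HasCommutator D (resolventCLM H z) (-(resolventCLM H z * C)) := by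
  rw [← ofBounded_resolventCLM hH hz] at hC
  refine .of_core hD hV fun x hx => ?_
  obtain ⟨hdom, hCx⟩ := hC x hx
  obtain ⟨_, hmem⟩ := mem_pcomp_domain.1 hdom
  obtain ⟨hHr, hDHr⟩ := mem_pcomp_domain.1 hmem.1
  obtain ⟨hDr, hHDr⟩ := mem_pcomp_domain.1 hmem.2
  have hcomm : D ⟨H ⟨resolventCLM H z x, hHr⟩, hDHr⟩ - H ⟨D ⟨resolventCLM H z x, hDr⟩, hHDr⟩ =
      C x := hCx
  obtain ⟨_, hHrx⟩ := resolventCLM_spec hH hz x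
  have hDH : D ⟨H ⟨resolventCLM H z x, hHr⟩, hDHr⟩ =
      D ⟨x, hV.le_domain hx⟩ + z • D ⟨resolventCLM H z x, hDr⟩ := by
    rw [← D.map_smul, ← D.map_add]
    exact congrArg D (Subtype.ext hHrx)
  have hrD : resolventCLM H z (D ⟨x, hV.le_domain hx⟩ - C x) = D ⟨resolventCLM H z x, hDr⟩ := by
    refine (resolventCLM_eq_iff hH hz).2 ⟨hHDr, ?_⟩
    rw [← hcomm, hDH]
    abel
  refine ⟨hDr, ?_⟩
  rw [← hrD, map_sub]
  exact sub_eq_add_neg _ _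

/-- The bounded operator `(H - w) (H - z)⁻¹`, for `z` off the spectrum of `H`. -/
noncomputable def cayley (H : E →ₗ.[ℂ] E) (w z : ℂ) : E →L[ℂ] E :=
  1 + (z - w) • resolventCLM H z

theorem cayley_mul_cayley (hH : IsSelfAdjoint H) (hz : z.im ≠ 0) (hw : w.im ≠ 0) :
    cayley H w z * cayley H z w = 1 := by
  have h := resolventCLM_sub hH hz hw
  simp only [cayley, add_mul, mul_add, one_mul, mul_one, smul_mul_smul_comm]
  rw [mul_smul, ← neg_sub z w]
  linear_combination (norm := module) (z - w) • h

theorem cayley_mul_resolventCLM (hH : IsSelfAdjoint H) (hz : z.im ≠ 0) (hw : w.im ≠ 0) :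
    cayley H w z * resolventCLM H w = resolventCLM H z := by
  have h := resolventCLM_sub hH hz hw
  rw [cayley, add_mul, one_mul, smul_mul_assoc, ← h]
  abel

theorem star_cayley (hH : IsSelfAdjoint H) (hz : z.im ≠ 0) :
    star (cayley H w z) = cayley H (star w) (star z) := by
  rw [cayley, star_add, star_one, star_smul, star_sub, star_resolventCLM hH hz]
  rfl

theorem commute_cayley_resolventCLM {v : ℂ} (hH : IsSelfAdjoint H) (hz : z.im ≠ 0)
    (hv : v.im ≠ 0) : Commute (cayley H w z) (resolventCLM H v) :=
  (Commute.one_left _).add_left ((commute_resolventCLM hH hz hv).smul_left _)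

theorem hasCommutator_resolventCLM (hD : IsSelfAdjoint D) (hH : IsSelfAdjoint H)
    (hz : z.im ≠ 0) (hw : w.im ≠ 0) (hK : HasCommutator D (resolventCLM H w) K) :
    HasCommutator D (resolventCLM H z) (cayley H w z * K * cayley H w z) := by
  rcases eq_or_ne z w with rfl | hne
  · simpa [cayley] using hK
  have hcayley : HasCommutator D (cayley H w z)
      (-(cayley H w z * (0 + (w - z) • K) * cayley H w z)) :=
    (HasCommutator.one.add (hK.smul (w - z))).inv hD (cayley_mul_cayley hH hw hz)
      (cayley_mul_cayley hH hz hw)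
  convert (hcayley.sub .one).smul (z - w)⁻¹ using 1
  · rw [cayley, add_sub_cancel_left, inv_smul_smul₀ (sub_ne_zero.2 hne)]
  · rw [zero_add, sub_zero, mul_smul_comm, smul_mul_assoc, ← neg_smul, neg_sub,
      inv_smul_smul₀ (sub_ne_zero.2 hne)]

theorem hasCommutator_resolventCLM_star_cayley (hD : IsSelfAdjoint D) (hH : IsSelfAdjoint H)
    (hz : z.im ≠ 0) (hw : w.im ≠ 0)
    (hC : HasCommutator D (resolventCLM H w) (-(resolventCLM H w * C))) :
    HasCommutator D (resolventCLM H z) (-(star (cayley H w (star z)) *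
      (resolventCLM H (star w) * C) * cayley H w z)) := by
  have hz' : (star z).im ≠ 0 := by simpa using hz
  have hw' : (star w).im ≠ 0 := by simpa using hw
  convert hasCommutator_resolventCLM hD hH hz hw hC using 1
  rw [mul_neg, neg_mul, ← mul_assoc (cayley H w z), cayley_mul_resolventCLM hH hz hw, ← mul_assoc,
    star_cayley hH hz', star_star, cayley_mul_resolventCLM hH hz hw']

theorem star_resolventCLM_mul (hD : IsSelfAdjoint D) (hH : IsSelfAdjoint H) (hw : w.im ≠ 0)
    (hC : HasCommutator D (resolventCLM H w) (-(resolventCLM H w * C))) :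
    star (resolventCLM H (star w) * C) = -(resolventCLM H (star w) * C) := by
  have hw' : (star w).im ≠ 0 := by simpa using hw
  have hstar := hC.star hD
  rw [star_resolventCLM hH hw] at hstar
  have h := hstar.unique hD.dense_domain
    (hasCommutator_resolventCLM_star_cayley hD hH hw' hw hC)
  have hone : cayley H w w = 1 := by rw [cayley, sub_self, zero_smul, add_zero]
  rw [star_star, hone, star_one, one_mul, star_neg, neg_neg, star_mul, star_resolventCLM hH hw] at h
  rw [star_mul, star_resolventCLM hH hw', star_star, ← cayley_mul_resolventCLM hH hw hw',
    (commute_cayley_resolventCLM hH hw hw').eq, ← mul_assoc, h, neg_mul, mul_assoc,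
    cayley_mul_cayley hH hw' hw, mul_one]

end ResolventCommutator

section Reid

theorem le_of_forall_sq_le_mul_of_forall_le_mul_pow {a : ℕ → ℝ} {b c : ℝ} (ha : ∀ n, 0 ≤ a n)
    (hc : 0 ≤ c) (hsq : ∀ n, a (n + 1) ^ 2 ≤ a n * a (n + 2)) (hle : ∀ n, a n ≤ b * c ^ n) :
    a 1 ≤ c * a 0 := by
  by_contra! hlt
  have h0 : 0 < a 0 := (ha 0).lt_of_ne fun h => by
    have := hsq 0
    simp only [← h, zero_mul] at this hlt
    nlinarith
  obtain ⟨q, hcq, hq1⟩ : ∃ q, c < q ∧ q * a 0 < a 1 := by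
    obtain ⟨q, hcq, hq⟩ := exists_between ((lt_div_iff₀ h0).2 hlt)
    exact ⟨q, hcq, (lt_div_iff₀ h0).1 hq⟩
  have hq : 0 < q := hc.trans_lt hcq
  have hratio : ∀ n, 0 < a n ∧ q * a n ≤ a (n + 1) := fun n => by
    induction n with
    | zero => exact ⟨h0, hq1.le⟩
    | succ n ih =>
      have hpos : 0 < a (n + 1) := (mul_pos hq ih.1).trans_le ih.2
      refine ⟨hpos, le_of_mul_le_mul_left ?_ ih.1⟩
      nlinarith [hsq n, mul_le_mul_of_nonneg_right ih.2 hpos.le]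
  have hgrowth : ∀ n, q ^ n * a 0 ≤ a n := fun n => by
    induction n with
    | zero => simp
    | succ n ih =>
      rw [pow_succ', mul_assoc]
      exact (mul_le_mul_of_nonneg_left ih hq.le).trans (hratio n).2
  have hlim : Filter.Tendsto (fun n => b * (c / q) ^ n) Filter.atTop (nhds 0) := by
    simpa using (tendsto_pow_atTop_nhds_zero_of_lt_one (div_nonneg hc hq.le)
      ((div_lt_one hq).2 hcq)).const_mul b
  refine h0.not_ge (ge_of_tendsto' hlim fun n => ?_)
  rw [div_pow, mul_div_assoc', le_div_iff₀ (pow_pos hq n), mul_comm]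
  exact (hgrowth n).trans (hle n)

theorem norm_map_le_of_inner_map_comm {𝕜 E F : Type*} [RCLike 𝕜] [NormedAddCommGroup E]
    [NormedSpace 𝕜 E] [NormedAddCommGroup F] [InnerProductSpace 𝕜 F]
    (T : E →L[𝕜] F) (c : E →L[𝕜] E)
    (h : ∀ x y, ⟪T (c x), T y⟫_𝕜 = ⟪T x, T (c y)⟫_𝕜) (x : E) : ‖T (c x)‖ ≤ ‖c‖ * ‖T x‖ := by
  have hsucc : ∀ n, (c ^ (n + 1)) x = c ((c ^ n) x) := fun n => by rw [pow_succ']; rfl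
  refine le_of_forall_sq_le_mul_of_forall_le_mul_pow (a := fun n => ‖T ((c ^ n) x)‖)
    (b := ‖T‖ * ‖x‖) (fun n => norm_nonneg _) (norm_nonneg c) (fun n => ?_) fun n => ?_
  · calc ‖T ((c ^ (n + 1)) x)‖ ^ 2
        = ‖⟪T ((c ^ n) x), T ((c ^ (n + 2)) x)⟫_𝕜‖ := by
          rw [hsucc (n + 1), ← h, ← hsucc, inner_self_eq_norm_sq_to_K, norm_pow, RCLike.norm_ofReal,
            abs_norm]
      _ ≤ ‖T ((c ^ n) x)‖ * ‖T ((c ^ (n + 2)) x)‖ := norm_inner_le_norm _ _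
  · have hpow : ‖(c ^ n) x‖ ≤ ‖c‖ ^ n * ‖x‖ := by
      induction n with
      | zero => simp
      | succ n ih =>
        rw [hsucc, pow_succ', mul_assoc]
        exact c.le_opNorm_of_le ih
    rw [mul_assoc, mul_comm ‖x‖]
    exact T.le_opNorm_of_le hpow

end Reid

section BoundedTransform

theorem exists_mul_eq_of_norm_le {𝕜 E F G : Type*} [NontriviallyNormedField 𝕜]
    [NormedAddCommGroup E] [NormedSpace 𝕜 E] [NormedAddCommGroup F] [NormedSpace 𝕜 F]
    [NormedAddCommGroup G] [NormedSpace 𝕜 G] [CompleteSpace G] {A : E →L[𝕜] G} {S : E →L[𝕜] F}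
    (hS : DenseRange S) (h : ∀ x, ‖A x‖ ≤ ‖S x‖) :
    ∃ W : F →L[𝕜] G, ‖W‖ ≤ 1 ∧ W ∘L S = A := by
  have hbound : ∀ x, ‖(A : E →ₗ[𝕜] G) x‖ ≤ 1 * ‖(S : E →ₗ[𝕜] F) x‖ := by simpa using h
  refine ⟨(A : E →ₗ[𝕜] G).extendOfNorm (S : E →ₗ[𝕜] F),
    LinearMap.opNorm_extendOfNorm_le hS zero_le_one hbound, ?_⟩
  ext x
  exact LinearMap.extendOfNorm_eq hS ⟨1, hbound⟩ x

theorem norm_map_eq_of_star_mul_self_eq {𝕜 E : Type*} [RCLike 𝕜] [NormedAddCommGroup E]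
    [InnerProductSpace 𝕜 E] [CompleteSpace E] {A B : E →L[𝕜] E} (h : star A * A = star B * B)
    (x : E) : ‖A x‖ = ‖B x‖ := by
  rw [ContinuousLinearMap.star_eq_adjoint, ContinuousLinearMap.star_eq_adjoint] at h
  rw [A.apply_norm_eq_sqrt_inner_adjoint_left, B.apply_norm_eq_sqrt_inner_adjoint_left]
  exact congrArg (fun T : E →L[𝕜] E => √(RCLike.re ⟪T x, x⟫_𝕜)) h

theorem denseRange_of_isSelfAdjoint_of_injective {𝕜 E : Type*} [RCLike 𝕜] [NormedAddCommGroup E]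
    [InnerProductSpace 𝕜 E] [CompleteSpace E] {S : E →L[𝕜] E} (hS : IsSelfAdjoint S)
    (hinj : Function.Injective S) : DenseRange S := by
  have h : S.range.topologicalClosure = ⊤ := by
    rw [Submodule.topologicalClosure_eq_top_iff, S.orthogonal_range,
      ContinuousLinearMap.isSelfAdjoint_iff'.1 hS]
    exact LinearMap.ker_eq_bot.2 hinj
  exact (Submodule.dense_iff_topologicalClosure_eq_top).2 h

variable {E : Type*} [NormedAddCommGroup E] [InnerProductSpace ℂ E] [CompleteSpace E]
  {H : E →ₗ.[ℂ] E}

theorem invOneAddSq_eq_resolventCLM_mul (hH : IsSelfAdjoint H) :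
    invOneAddSq H = resolventCLM H Complex.I * resolventCLM H (-Complex.I) := by
  ext x
  obtain ⟨hx, hHx⟩ := resolventCLM_spec hH (z := -Complex.I) (by simp) x
  set u := resolventCLM H (-Complex.I) x
  obtain ⟨hy, hHy⟩ := resolventCLM_spec hH (z := Complex.I) (by simp) u
  set y := resolventCLM H Complex.I u
  have hHy_mem : H ⟨y, hy⟩ ∈ H.domain := hHy ▸ add_mem hx (H.domain.smul_mem _ hy)
  have hHHy : H ⟨H ⟨y, hy⟩, hHy_mem⟩ = x - y := by
    have hsub : (⟨H ⟨y, hy⟩, hHy_mem⟩ : H.domain) = ⟨u, hx⟩ + Complex.I • ⟨y, hy⟩ :=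
      Subtype.ext hHy
    rw [hsub, H.map_add, H.map_smul, hHx, hHy, smul_add, smul_smul, Complex.I_mul_I]
    module
  have hadj : oneAddSq H = (LinearMap.id : E →ₗ[ℂ] E) +ᵥ pcomp H H := by
    rw [oneAddSq, LinearPMap.isSelfAdjoint_def.1 hH]
  have hdom : y ∈ (oneAddSq H).domain := by
    rw [hadj]
    exact mem_pcomp_domain.2 ⟨hy, hHy_mem⟩
  have heq : oneAddSq H ⟨y, hdom⟩ = x := by
    obtain ⟨_, happly⟩ := LinearPMap.ext_iff.1 hadj
    refine (happly (hg := mem_pcomp_domain.2 ⟨hy, hHy_mem⟩)).trans ?_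
    exact (congrArg (y + ·) hHHy).trans (add_sub_cancel _ _)
  obtain ⟨hle, hspec⟩ := LinearPMap.ext_iff.1 (invOneAddSq_spec hH.isClosed hH.dense_domain)
  exact (hspec (hf := trivial) (hg := hle.le trivial)).trans
    (LinearPMap.inverse_apply_eq (oneAddSq_ker hH.dense_domain) (x := ⟨y, hdom⟩) heq)

theorem invSqrtOneAddSq_mul_self (hH : IsSelfAdjoint H) :
    invSqrtOneAddSq H * invSqrtOneAddSq H = invOneAddSq H :=
  CFC.sqrt_mul_sqrt_self _ (invOneAddSq_nonneg hH.isClosed hH.dense_domain)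

theorem isSelfAdjoint_invSqrtOneAddSq (H : E →ₗ.[ℂ] E) : IsSelfAdjoint (invSqrtOneAddSq H) :=
  .of_nonneg (CFC.sqrt_nonneg _)

theorem norm_resolventCLM_neg_I_apply (hH : IsSelfAdjoint H) (x : E) :
    ‖resolventCLM H (-Complex.I) x‖ = ‖invSqrtOneAddSq H x‖ := by
  refine norm_map_eq_of_star_mul_self_eq ?_ x
  rw [isSelfAdjoint_invSqrtOneAddSq H, invSqrtOneAddSq_mul_self hH,
    invOneAddSq_eq_resolventCLM_mul hH, star_resolventCLM hH (by simp)]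
  simp

theorem injective_invSqrtOneAddSq (hH : IsSelfAdjoint H) :
    Function.Injective (invSqrtOneAddSq H) := by
  refine (injective_iff_map_eq_zero _).2 fun x hx => ?_
  have hr : resolventCLM H (-Complex.I) x = 0 := by
    rw [← norm_eq_zero, norm_resolventCLM_neg_I_apply hH, hx, norm_zero]
  obtain ⟨hmem, hHr⟩ := resolventCLM_spec hH (z := -Complex.I) (by simp) x
  have hzero : (⟨resolventCLM H (-Complex.I) x, hmem⟩ : H.domain) = 0 := Subtype.ext hr
  rwa [hzero, H.map_zero, hr, smul_zero, add_zero, eq_comm] at hHr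

theorem denseRange_invSqrtOneAddSq (hH : IsSelfAdjoint H) : DenseRange (invSqrtOneAddSq H) :=
  denseRange_of_isSelfAdjoint_of_injective (isSelfAdjoint_invSqrtOneAddSq H)
    (injective_invSqrtOneAddSq hH)

theorem commute_invSqrtOneAddSq {T : E →L[ℂ] E} (hH : IsSelfAdjoint H)
    (hT : ∀ z : ℂ, z.im ≠ 0 → Commute (resolventCLM H z) T) : Commute (invSqrtOneAddSq H) T := by
  have h : Commute (invOneAddSq H) T := by
    rw [invOneAddSq_eq_resolventCLM_mul hH]
    exact (hT _ (by simp)).mul_left (hT _ (by simp))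
  rw [invSqrtOneAddSq, CFC.sqrt_eq_real_sqrt _ (invOneAddSq_nonneg hH.isClosed hH.dense_domain)]
  exact h.cfcₙ_real _

theorem resolventCLM_I_sub (hH : IsSelfAdjoint H) :
    resolventCLM H Complex.I - resolventCLM H (-Complex.I) =
      (2 * Complex.I) • invOneAddSq H := by
  rw [resolventCLM_sub hH (by simp) (by simp), ← invOneAddSq_eq_resolventCLM_mul hH,
    sub_neg_eq_add, two_mul]

theorem invSqrtOneAddSq_invSqrtOneAddSq_apply (hH : IsSelfAdjoint H) (x : E) :
    invSqrtOneAddSq H (invSqrtOneAddSq H x) =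
      resolventCLM H Complex.I (resolventCLM H (-Complex.I) x) :=
  DFunLike.congr_fun ((invSqrtOneAddSq_mul_self hH).trans (invOneAddSq_eq_resolventCLM_mul hH)) x

theorem exists_ofBounded_eq_boundedTransform (hH : IsSelfAdjoint H) :
    ∃ m : E →L[ℂ] E, ofBounded m = boundedTransform H := by
  obtain ⟨W, -, hW⟩ := exists_mul_eq_of_norm_le (denseRange_invSqrtOneAddSq hH)
    fun x => (norm_resolventCLM_neg_I_apply hH x).le
  let m := W + Complex.I • invSqrtOneAddSq H
  have hgraph : ∀ x, (invSqrtOneAddSq H x, m x) ∈ H.graph := by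
    intro x
    have hclosed : IsClosed (H.graph : Set (E × E)) := hH.isClosed
    refine (denseRange_invSqrtOneAddSq hH).induction_on
      (p := fun x => (invSqrtOneAddSq H x, m x) ∈ H.graph) x
      (hclosed.preimage (f := fun x => (invSqrtOneAddSq H x, m x)) (by fun_prop)) fun v => ?_
    obtain ⟨hmem, heq⟩ := resolventCLM_spec hH (z := Complex.I) (by simp)
      (resolventCLM H (-Complex.I) v)
    have hsq := invSqrtOneAddSq_invSqrtOneAddSq_apply hH v
    refine (LinearPMap.mem_graph_iff _).2 ⟨⟨_, hmem⟩, hsq.symm, heq.trans ?_⟩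
    rw [← hsq, ← hW]
    rfl
  refine ⟨m, LinearPMap.ext (Eq.symm (Submodule.eq_top_iff'.2 fun x => ?_)) fun {x} _ hx => ?_⟩
  · exact mem_pcomp_domain.2 ⟨trivial, LinearPMap.mem_domain_of_mem_graph (hgraph x)⟩
  · obtain ⟨_, hSx⟩ := mem_pcomp_domain.1 hx
    exact (LinearPMap.image_iff hSx).2 (hgraph x)

open scoped Classical in
/-- The bounded transform `F(H)` as a bounded operator; it is `0` when `boundedTransform H` is not
bounded and everywhere defined. -/
noncomputable def boundedTransformCLM (H : E →ₗ.[ℂ] E) : E →L[ℂ] E :=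
  if h : ∃ m : E →L[ℂ] E, ofBounded m = boundedTransform H then h.choose else 0

theorem ofBounded_boundedTransformCLM (hH : IsSelfAdjoint H) :
    ofBounded (boundedTransformCLM H) = boundedTransform H := by
  have h := exists_ofBounded_eq_boundedTransform hH
  rw [boundedTransformCLM, dif_pos h]
  exact h.choose_spec

theorem boundedTransformCLM_mul_invSqrtOneAddSq (hH : IsSelfAdjoint H) :
    boundedTransformCLM H * invSqrtOneAddSq H =
      (2⁻¹ : ℂ) • (resolventCLM H Complex.I + resolventCLM H (-Complex.I)) := by
  have hmul : boundedTransformCLM H * invSqrtOneAddSq H =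
      resolventCLM H (-Complex.I) + Complex.I • invOneAddSq H := by
    ext v
    obtain ⟨hmem, heq⟩ := resolventCLM_spec hH (z := Complex.I) (by simp)
      (resolventCLM H (-Complex.I) v)
    obtain ⟨hdom, hF⟩ := LinearPMap.ext_iff.1 (ofBounded_boundedTransformCLM hH)
    have hsq := invSqrtOneAddSq_invSqrtOneAddSq_apply hH v
    refine (hF (hf := trivial) (hg := hdom.le trivial)).trans
      ((congrArg H (Subtype.ext hsq)).trans (heq.trans ?_))
    rw [invOneAddSq_eq_resolventCLM_mul hH]
    rfl
  rw [hmul]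
  linear_combination (norm := module) (-2⁻¹ : ℂ) • resolventCLM_I_sub hH

theorem commute_boundedTransformCLM {T : E →L[ℂ] E} (hH : IsSelfAdjoint H)
    (hT : ∀ z : ℂ, z.im ≠ 0 → Commute (resolventCLM H z) T) :
    Commute (boundedTransformCLM H) T := by
  have hA : Commute (boundedTransformCLM H * invSqrtOneAddSq H) T := by
    rw [boundedTransformCLM_mul_invSqrtOneAddSq hH]
    exact ((hT _ (by simp)).add_left (hT _ (by simp))).smul_left _
  have hS := commute_invSqrtOneAddSq hH hT
  have hmul : boundedTransformCLM H * T * invSqrtOneAddSq H =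
      T * boundedTransformCLM H * invSqrtOneAddSq H := by
    rw [mul_assoc, ← hS.eq, ← mul_assoc, hA.eq, mul_assoc]
  exact DFunLike.coe_injective ((denseRange_invSqrtOneAddSq hH).equalizer
    (ContinuousLinearMap.continuous _) (ContinuousLinearMap.continuous _)
    (congrArg DFunLike.coe hmul))

theorem commute_invSqrtOneAddSq_resolventCLM {z : ℂ} (hH : IsSelfAdjoint H) (hz : z.im ≠ 0) :
    Commute (invSqrtOneAddSq H) (resolventCLM H z) :=
  commute_invSqrtOneAddSq hH fun _ hw => commute_resolventCLM hH hw hz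

theorem isSelfAdjoint_boundedTransformCLM (hH : IsSelfAdjoint H) :
    IsSelfAdjoint (boundedTransformCLM H) := by
  have hcomm := commute_boundedTransformCLM hH
    fun z hz => (commute_invSqrtOneAddSq_resolventCLM hH hz).symm
  have hstar : star (boundedTransformCLM H * invSqrtOneAddSq H) =
      boundedTransformCLM H * invSqrtOneAddSq H := by
    rw [boundedTransformCLM_mul_invSqrtOneAddSq hH, star_smul, star_add,
      star_resolventCLM hH (by simp), star_resolventCLM hH (by simp), star_neg]
    simp [add_comm]
  rw [star_mul, isSelfAdjoint_invSqrtOneAddSq H, hcomm.eq] at hstar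
  exact ContinuousLinearMap.ext fun x =>
    injective_invSqrtOneAddSq hH (DFunLike.congr_fun hstar x)

theorem IsAffiliated.boundedTransformCLM_mem {N : VonNeumannAlgebra E} (hN : IsAffiliated N H)
    (hH : IsSelfAdjoint H) : boundedTransformCLM H ∈ N :=
  mem_of_forall_unitary_commute fun _ _ hUN => commute_boundedTransformCLM hH fun _ hz =>
    VonNeumannAlgebra.mem_commutant_iff.1 hUN _ (hN.resolventCLM_mem hH hz)

end BoundedTransform

section Quadrature

theorem monotoneOn_comp_mul_div {f : ℝ → ℝ} {b : ℝ} (n : ℕ) (hb : 0 ≤ b)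
    (hf : MonotoneOn f (Set.Icc 0 b)) :
    MonotoneOn (fun x => f (x * (b / n))) (Set.Icc 0 (0 + n)) := by
  have hmem : ∀ x ∈ Set.Icc 0 (0 + (n : ℝ)), x * (b / n) ∈ Set.Icc 0 b := by
    rintro x ⟨hx₀, hx⟩
    rw [zero_add] at hx
    refine ⟨by positivity, ?_⟩
    rw [mul_div_assoc']
    exact div_le_of_le_mul₀ n.cast_nonneg hb (by rw [mul_comm b]; gcongr)
  exact fun x hx y hy hxy => hf (hmem x hx) (hmem y hy) (by gcongr)

theorem sum_le_integral_of_monotoneOn {f : ℝ → ℝ} {b : ℝ} {n : ℕ} (hn : n ≠ 0) (hb : 0 ≤ b)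
    (hf : MonotoneOn f (Set.Icc 0 b)) :
    b / n * ∑ k ∈ Finset.range n, f (k * (b / n)) ≤ ∫ x in 0..b, f x := by
  have h := mul_le_mul_of_nonneg_left (monotoneOn_comp_mul_div n hb hf).sum_le_integral
    (div_nonneg hb n.cast_nonneg)
  rw [intervalIntegral.mul_integral_comp_mul_right] at h
  simpa [mul_div_cancel₀, hn] using h

theorem integral_le_sum_of_monotoneOn {f : ℝ → ℝ} {b : ℝ} {n : ℕ} (hn : n ≠ 0) (hb : 0 ≤ b)
    (hf : MonotoneOn f (Set.Icc 0 b)) :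
    ∫ x in 0..b, f x ≤ b / n * (∑ k ∈ Finset.range n, f (k * (b / n)) + (f b - f 0)) := by
  have hn' : (n : ℝ) ≠ 0 := by simpa using hn
  have h := mul_le_mul_of_nonneg_left (monotoneOn_comp_mul_div n hb hf).integral_le_sum
    (div_nonneg hb n.cast_nonneg)
  rw [intervalIntegral.mul_integral_comp_mul_right] at h
  have hshift := Finset.sum_range_sub (fun k : ℕ => f (k * (b / n))) n
  rw [Finset.sum_sub_distrib, sub_eq_iff_eq_add'] at hshift
  simp only [zero_add, hshift] at h
  simpa [mul_div_cancel₀, hn'] using h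

theorem integral_inv_cos_sq_add_mul_sin_sq {t : ℝ} (ht : 0 < t) :
    ∫ θ in 0..(Real.pi / 2), (Real.cos θ ^ 2 + t * Real.sin θ ^ 2)⁻¹ = Real.pi / 2 / √t := by
  have hpos : ∀ θ, 0 < Real.cos θ ^ 2 + t * Real.sin θ ^ 2 := fun θ => by
    nlinarith [Real.sin_sq_add_cos_sq θ, sq_nonneg (Real.sin θ), sq_nonneg (Real.cos θ),
      mul_nonneg ht.le (sq_nonneg (Real.sin θ))]
  have hsqrt : 0 < √t := Real.sqrt_pos.2 ht
  have hderiv : ∀ θ ∈ Set.Ioo 0 (Real.pi / 2),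
      HasDerivAt (fun θ => Real.arctan (√t * Real.tan θ) / √t)
        (Real.cos θ ^ 2 + t * Real.sin θ ^ 2)⁻¹ θ := fun θ hθ => by
    have hcos : 0 < Real.cos θ := Real.cos_pos_of_mem_Ioo ⟨by linarith [hθ.1, hθ.2], hθ.2⟩
    refine (((Real.hasDerivAt_tan hcos.ne').const_mul √t).arctan.div_const √t).congr_deriv ?_
    rw [Real.tan_eq_sin_div_cos, mul_pow, Real.sq_sqrt ht.le]
    have := (hpos θ).ne'
    field_simp
  have hzero : Filter.Tendsto (fun θ => Real.arctan (√t * Real.tan θ) / √t)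
      (nhdsWithin 0 (Set.Ioi 0)) (nhds 0) := by
    have hcont : ContinuousAt (fun θ => Real.arctan (√t * Real.tan θ) / √t) 0 :=
      ((Real.hasDerivAt_tan (by simp)).const_mul √t).arctan.continuousAt.div_const _
    simpa [ContinuousAt] using hcont.tendsto.mono_left nhdsWithin_le_nhds
  have htop : Filter.Tendsto (fun θ => Real.arctan (√t * Real.tan θ) / √t)
      (nhdsWithin (Real.pi / 2) (Set.Iio (Real.pi / 2))) (nhds (Real.pi / 2 / √t)) :=
    ((tendsto_nhds_of_tendsto_nhdsWithin Real.tendsto_arctan_atTop).comp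
      (Real.tendsto_tan_pi_div_two.const_mul_atTop hsqrt)).div_const _
  rw [intervalIntegral.integral_eq_sub_of_hasDerivAt_of_tendsto Real.pi_div_two_pos hderiv
    (Continuous.intervalIntegrable (by fun_prop (disch := exact fun θ => (hpos θ).ne')) _ _)
    hzero htop, sub_zero]

theorem monotoneOn_inv_cos_sq_add_mul_sin_sq {t : ℝ} (ht₀ : 0 < t) (ht₁ : t ≤ 1) :
    MonotoneOn (fun θ => (Real.cos θ ^ 2 + t * Real.sin θ ^ 2)⁻¹) (Set.Icc 0 (Real.pi / 2)) := by
  intro x hx y hy hxy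
  have hsin : Real.sin x ≤ Real.sin y :=
    Real.sin_le_sin_of_le_of_le_pi_div_two (by linarith [hx.1, Real.pi_pos]) hy.2 hxy
  have hsin_sq : Real.sin x ^ 2 ≤ Real.sin y ^ 2 :=
    pow_le_pow_left₀ (Real.sin_nonneg_of_nonneg_of_le_pi hx.1 (by linarith [hx.2, Real.pi_pos]))
      hsin 2
  have hpos : 0 < Real.cos y ^ 2 + t * Real.sin y ^ 2 := by
    nlinarith [Real.sin_sq_add_cos_sq y, sq_nonneg (Real.sin y), sq_nonneg (Real.cos y)]
  refine inv_anti₀ hpos ?_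
  rw [Real.cos_sq', Real.cos_sq']
  nlinarith

/-- The function `x ↦ |(x + i) / (x - iμ)|²` in the variable `t = (1 + x²)⁻¹`. -/
noncomputable def cayleySq (μ t : ℝ) : ℝ := (1 + (μ ^ 2 - 1) * t)⁻¹

/-- The values `1 / cos θ` at the left endpoints `θ = kπ / 2n`, `k < n`, of a subdivision of
`[0, π / 2]`. -/
noncomputable def secNode (n k : ℕ) : ℝ := (Real.cos (k * (Real.pi / 2 / n)))⁻¹

/-- The Riemann sum of the integral `(2 / π) ∫ (cos² θ + t sin² θ)⁻¹ dθ = t ^ (-1/2)` over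
`[0, π / 2]`, written in the variable `μ = 1 / cos θ`. -/
noncomputable def invSqrtSum (n : ℕ) (t : ℝ) : ℝ :=
  ∑ k ∈ Finset.range n, secNode n k ^ 2 / n * cayleySq (secNode n k) t

theorem ne_zero_of_one_le_sq {μ : ℝ} (hμ : 1 ≤ μ ^ 2) : μ ≠ 0 := by
  rintro rfl
  norm_num at hμ

theorem one_le_secNode_sq {n k : ℕ} (hk : k < n) : 1 ≤ secNode n k ^ 2 := by
  have hn : (0 : ℝ) < n := by exact_mod_cast (Nat.zero_le k).trans_lt hk
  have hkn : (k : ℝ) < n := by exact_mod_cast hk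
  refine one_le_pow₀ ((one_le_inv₀ (Real.cos_pos_of_mem_Ioo ⟨?_, ?_⟩)).2 (Real.cos_le_one _))
  · exact (neg_neg_of_pos Real.pi_div_two_pos).trans_le (by positivity)
  · rw [mul_div_assoc', div_lt_iff₀ hn, mul_comm]
    exact mul_lt_mul_of_pos_left hkn Real.pi_div_two_pos

theorem pi_div_two_mul_invSqrtSum (n : ℕ) (t : ℝ) :
    Real.pi / 2 * invSqrtSum n t = Real.pi / 2 / n * ∑ k ∈ Finset.range n,
      (Real.cos (k * (Real.pi / 2 / n)) ^ 2 + t * Real.sin (k * (Real.pi / 2 / n)) ^ 2)⁻¹ := by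
  rw [invSqrtSum, Finset.mul_sum, Finset.mul_sum]
  refine Finset.sum_congr rfl fun k hk => ?_
  have hsec := ne_zero_of_one_le_sq (one_le_secNode_sq (Finset.mem_range.1 hk))
  have hcayley : secNode n k ^ 2 * cayleySq (secNode n k) t =
      (Real.cos (k * (Real.pi / 2 / n)) ^ 2 + t * Real.sin (k * (Real.pi / 2 / n)) ^ 2)⁻¹ := by
    have hcos : Real.cos (k * (Real.pi / 2 / n)) = (secNode n k)⁻¹ := (inv_inv _).symm
    rw [Real.sin_sq, hcos, cayleySq, ← inv_inv (secNode n k ^ 2), ← mul_inv]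
    congr 1
    field_simp
  rw [← hcayley]
  ring

theorem cayleySq_nonneg {μ t : ℝ} (hμ : 1 ≤ μ ^ 2) (ht : 0 ≤ t) : 0 ≤ cayleySq μ t :=
  inv_nonneg.2 (add_nonneg zero_le_one (mul_nonneg (sub_nonneg.2 hμ) ht))

theorem invSqrtSum_nonneg (n : ℕ) {t : ℝ} (ht : 0 ≤ t) : 0 ≤ invSqrtSum n t :=
  Finset.sum_nonneg fun _ hk =>
    mul_nonneg (by positivity) (cayleySq_nonneg (one_le_secNode_sq (Finset.mem_range.1 hk)) ht)

theorem sqrt_mul_invSqrtSum_le_one {n : ℕ} (hn : n ≠ 0) {t : ℝ} (ht₀ : 0 ≤ t) (ht₁ : t ≤ 1) :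
    √t * invSqrtSum n t ≤ 1 := by
  rcases ht₀.eq_or_lt with rfl | ht
  · simp
  have h := sum_le_integral_of_monotoneOn hn Real.pi_div_two_pos.le
    (monotoneOn_inv_cos_sq_add_mul_sin_sq ht ht₁)
  rw [integral_inv_cos_sq_add_mul_sin_sq ht, ← pi_div_two_mul_invSqrtSum, div_eq_mul_inv _ √t,
    mul_le_mul_iff_right₀ Real.pi_div_two_pos] at h
  rwa [← le_inv_mul_iff₀ (Real.sqrt_pos.2 ht), mul_one]

theorem sqrt_sub_mul_invSqrtSum_le {n : ℕ} (hn : n ≠ 0) {t : ℝ} (ht₀ : 0 ≤ t) (ht₁ : t ≤ 1) :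
    √t - t * invSqrtSum n t ≤ (n : ℝ)⁻¹ := by
  rcases ht₀.eq_or_lt with rfl | ht
  · simp
  have h := integral_le_sum_of_monotoneOn hn Real.pi_div_two_pos.le
    (monotoneOn_inv_cos_sq_add_mul_sin_sq ht ht₁)
  have hends : (Real.cos (Real.pi / 2) ^ 2 + t * Real.sin (Real.pi / 2) ^ 2)⁻¹ -
      (Real.cos 0 ^ 2 + t * Real.sin 0 ^ 2)⁻¹ = t⁻¹ - 1 := by simp
  rw [integral_inv_cos_sq_add_mul_sin_sq ht, hends, mul_add, ← pi_div_two_mul_invSqrtSum,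
    div_eq_mul_inv _ (n : ℝ), mul_assoc, ← mul_add, div_eq_mul_inv _ √t,
    mul_le_mul_iff_right₀ Real.pi_div_two_pos] at h
  calc √t - t * invSqrtSum n t
      = t * ((√t)⁻¹ - invSqrtSum n t) := by rw [mul_sub, ← div_eq_mul_inv, Real.div_sqrt]
    _ ≤ t * ((n : ℝ)⁻¹ * (t⁻¹ - 1)) := by gcongr; linarith
    _ = (1 - t) * (n : ℝ)⁻¹ := by field_simp
    _ ≤ (n : ℝ)⁻¹ := mul_le_of_le_one_left (by positivity) (by linarith)

end Quadrature

section FunctionalCalculus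

theorem tendsto_apply_of_tendsto_comp {𝕜 E F ι : Type*} [NontriviallyNormedField 𝕜]
    [NormedAddCommGroup E] [NormedSpace 𝕜 E] [NormedAddCommGroup F] [NormedSpace 𝕜 F]
    {l : Filter ι} {J : ι → F →L[𝕜] F} {S : E →L[𝕜] F} {c : ℝ≥0} (hS : DenseRange S)
    (hJ : ∀ i, ‖J i‖ ≤ c) (hlim : Filter.Tendsto (fun i => J i ∘L S) l (nhds S)) (x : F) :
    Filter.Tendsto (fun i => J i x) l (nhds x) := by
  have hequi := (LipschitzWith.uniformEquicontinuous (fun i => ⇑(J i)) c fun i =>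
    (J i).lipschitz.weaken (hJ i)).equicontinuous
  refine (hequi x).tendsto_of_mem_closure (f := id) (s := Set.range S) nhdsWithin_le_nhds ?_ (hS x)
  rintro _ ⟨v, rfl⟩
  exact ((ContinuousLinearMap.apply 𝕜 F v).continuous.tendsto S).comp hlim

theorem continuousOn_cayleySq {μ : ℝ} (hμ : 1 ≤ μ ^ 2) : ContinuousOn (cayleySq μ) (Set.Ici 0) := by
  refine ContinuousOn.inv₀ (by fun_prop) fun t ht => ne_of_gt ?_
  exact add_pos_of_pos_of_nonneg one_pos (mul_nonneg (sub_nonneg.2 hμ) ht)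

theorem continuousOn_invSqrtSum (n : ℕ) : ContinuousOn (invSqrtSum n) (Set.Ici 0) :=
  continuousOn_finsetSum _ fun _ hk =>
    (continuousOn_cayleySq (one_le_secNode_sq (Finset.mem_range.1 hk))).const_mul _

variable {E : Type*} [NormedAddCommGroup E] [InnerProductSpace ℂ E] [CompleteSpace E]
  {H : E →ₗ.[ℂ] E}

theorem spectrum_invOneAddSq_subset (hH : IsSelfAdjoint H) :
    spectrum ℝ (invOneAddSq H) ⊆ Set.Icc 0 1 := by
  have hnorm : ‖invOneAddSq H‖ ≤ 1 := by
    have hI := norm_resolventCLM_le hH (z := Complex.I) (by simp)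
    have hI' := norm_resolventCLM_le hH (z := -Complex.I) (by simp)
    rw [invOneAddSq_eq_resolventCLM_mul hH]
    exact (norm_mul_le _ _).trans (mul_le_one₀ (by simpa using hI) (norm_nonneg _)
      (by simpa using hI'))
  refine fun t ht => ⟨spectrum_nonneg_of_nonneg
    (invOneAddSq_nonneg hH.isClosed hH.dense_domain) ht, (le_abs_self t).trans ?_⟩
  exact (spectrum.norm_le_norm_mul_of_mem ht).trans
    (mul_le_one₀ hnorm (norm_nonneg _) ContinuousLinearMap.norm_id_le)

theorem isSelfAdjoint_invOneAddSq (hH : IsSelfAdjoint H) : IsSelfAdjoint (invOneAddSq H) :=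
  .of_nonneg (invOneAddSq_nonneg hH.isClosed hH.dense_domain)

theorem invSqrtOneAddSq_eq_cfc (hH : IsSelfAdjoint H) :
    invSqrtOneAddSq H = cfc Real.sqrt (invOneAddSq H) := by
  rw [invSqrtOneAddSq, CFC.sqrt_eq_real_sqrt _ (invOneAddSq_nonneg hH.isClosed hH.dense_domain),
    cfcₙ_eq_cfc]

theorem cayley_mul_cayley_neg_I (hH : IsSelfAdjoint H) (μ : ℝ) :
    cayley H (Complex.I * μ) (-Complex.I) * cayley H (-(Complex.I * μ)) Complex.I =
      1 + (μ ^ 2 - 1) • invOneAddSq H := by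
  have hsub : (Complex.I * (1 + μ)) • (resolventCLM H Complex.I - resolventCLM H (-Complex.I)) =
      (-2 * (1 + μ : ℂ)) • invOneAddSq H := by
    rw [resolventCLM_I_sub hH, smul_smul]
    congr 1
    linear_combination 2 * (1 + μ : ℂ) * Complex.I_mul_I
  have hmul := (commute_resolventCLM hH (z := -Complex.I) (w := Complex.I)
    (by simp) (by simp)).eq.trans (invOneAddSq_eq_resolventCLM_mul hH).symm
  have hscalar :
      (-Complex.I - Complex.I * μ) * (Complex.I - -(Complex.I * μ)) = (1 + μ : ℂ) ^ 2 := by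
    linear_combination -(1 + μ : ℂ) ^ 2 * Complex.I_mul_I
  have hreal : (μ ^ 2 - 1) • invOneAddSq H = ((μ : ℂ) ^ 2 - 1) • invOneAddSq H := by
    rw [← Complex.coe_smul]
    push_cast
    rfl
  simp only [cayley, add_mul, mul_add, one_mul, mul_one, smul_mul_smul_comm, hmul, hreal, hscalar]
  linear_combination (norm := module) hsub

theorem cfc_cayleySq_invOneAddSq (hH : IsSelfAdjoint H) {μ : ℝ} (hμ : 1 ≤ μ ^ 2) :
    cfc (cayleySq μ) (invOneAddSq H) =
      cayley H Complex.I (-(Complex.I * μ)) * cayley H (-Complex.I) (Complex.I * μ) := by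
  have hspec := (spectrum_invOneAddSq_subset hH).trans Set.Icc_subset_Ici_self
  have hcont := (continuousOn_cayleySq hμ).mono hspec
  have hsa := isSelfAdjoint_invOneAddSq hH
  have hleft : cfc (cayleySq μ) (invOneAddSq H) * (1 + (μ ^ 2 - 1) • invOneAddSq H) = 1 := by
    have haff : cfc (fun t : ℝ => 1 + (μ ^ 2 - 1) * t) (invOneAddSq H) =
        1 + (μ ^ 2 - 1) • invOneAddSq H := by
      rw [cfc_add _ (fun _ => 1) fun t => (μ ^ 2 - 1) * t, cfc_const_one ℝ _,
        cfc_const_mul_id _ _ hsa]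
    rw [← haff, ← cfc_mul (cayleySq μ) _ _ hcont]
    refine (cfc_congr fun t ht => inv_mul_cancel₀ (ne_of_gt ?_)).trans (cfc_const_one ℝ _)
    exact add_pos_of_pos_of_nonneg one_pos (mul_nonneg (sub_nonneg.2 hμ) (hspec ht))
  have hμ' : (Complex.I * μ).im ≠ 0 := by simpa using ne_zero_of_one_le_sq hμ
  have hμ'' : (-(Complex.I * μ)).im ≠ 0 := by simpa using ne_zero_of_one_le_sq hμ
  refine left_inv_eq_right_inv hleft ?_
  rw [← cayley_mul_cayley_neg_I hH, mul_assoc,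
    ← mul_assoc (cayley H (-(Complex.I * μ)) Complex.I),
    cayley_mul_cayley hH (by simp) hμ'', one_mul, cayley_mul_cayley hH (by simp) hμ']

theorem resolventCLM_I_add_mul_cfc_cayleySq (hH : IsSelfAdjoint H) {μ : ℝ} (hμ : 1 ≤ μ ^ 2) :
    (resolventCLM H Complex.I + resolventCLM H (-Complex.I)) *
      cfc (cayleySq μ) (invOneAddSq H) =
    resolventCLM H (Complex.I * μ) + resolventCLM H (-(Complex.I * μ)) := by
  have hμ' : (Complex.I * μ).im ≠ 0 := by simpa using ne_zero_of_one_le_sq hμ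
  have hμ'' : (-(Complex.I * μ)).im ≠ 0 := by simpa using ne_zero_of_one_le_sq hμ
  have hneg : resolventCLM H (-Complex.I) * (cayley H Complex.I (-(Complex.I * μ)) *
      cayley H (-Complex.I) (Complex.I * μ)) =
      cayley H Complex.I (-(Complex.I * μ)) * resolventCLM H (Complex.I * μ) := by
    rw [← mul_assoc, ← (commute_cayley_resolventCLM hH hμ'' (by simp)).eq, mul_assoc,
      ← (commute_cayley_resolventCLM hH hμ' (by simp)).eq,
      cayley_mul_resolventCLM hH hμ' (by simp)]
  rw [cfc_cayleySq_invOneAddSq hH hμ, add_mul, hneg, ← mul_assoc,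
    ← (commute_cayley_resolventCLM hH hμ'' (by simp)).eq,
    cayley_mul_resolventCLM hH hμ'' (by simp), cayley, cayley, mul_add, add_mul, mul_one, one_mul,
    mul_smul_comm, smul_mul_assoc, (commute_resolventCLM hH hμ'' hμ').eq]
  module

/-- The approximation of `F(H)` by resolvents obtained from the quadrature formula
`invSqrtSum n` for `t ^ (-1/2)`. -/
noncomputable def boundedTransformSum (H : E →ₗ.[ℂ] E) (n : ℕ) : E →L[ℂ] E :=
  ∑ k ∈ Finset.range n, ((secNode n k ^ 2 / n / 2 : ℝ) : ℂ) •
    (resolventCLM H (Complex.I * secNode n k) + resolventCLM H (-(Complex.I * secNode n k)))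

theorem cfc_invSqrtSum (hH : IsSelfAdjoint H) (n : ℕ) :
    cfc (invSqrtSum n) (invOneAddSq H) = ∑ k ∈ Finset.range n,
      (secNode n k ^ 2 / n) • cfc (cayleySq (secNode n k)) (invOneAddSq H) := by
  have hspec := (spectrum_invOneAddSq_subset hH).trans Set.Icc_subset_Ici_self
  have hcont : ∀ k ∈ Finset.range n, ContinuousOn (cayleySq (secNode n k))
      (spectrum ℝ (invOneAddSq H)) := fun k hk =>
    (continuousOn_cayleySq (one_le_secNode_sq (Finset.mem_range.1 hk))).mono hspec
  have hsum : invSqrtSum n = ∑ k ∈ Finset.range n,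
      fun t => secNode n k ^ 2 / n * cayleySq (secNode n k) t := by
    ext t
    rw [invSqrtSum, Finset.sum_apply]
  rw [hsum, cfc_sum _ _ _ (hf := fun k hk => (hcont k hk).const_mul _)]
  exact Finset.sum_congr rfl fun k hk => cfc_const_mul _ _ _ (hcont k hk)

theorem boundedTransformSum_eq (hH : IsSelfAdjoint H) (n : ℕ) :
    boundedTransformSum H n = boundedTransformCLM H *
      (invSqrtOneAddSq H * cfc (invSqrtSum n) (invOneAddSq H)) := by
  rw [← mul_assoc, boundedTransformCLM_mul_invSqrtOneAddSq hH, cfc_invSqrtSum hH, Finset.mul_sum,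
    boundedTransformSum]
  refine Finset.sum_congr rfl fun k hk => ?_
  rw [← resolventCLM_I_add_mul_cfc_cayleySq hH (one_le_secNode_sq (Finset.mem_range.1 hk)),
    mul_smul_comm, smul_mul_assoc, ← Complex.coe_smul, smul_smul]
  push_cast
  rfl

theorem norm_invSqrtOneAddSq_mul_cfc_le_one (hH : IsSelfAdjoint H) {n : ℕ} (hn : n ≠ 0) :
    ‖invSqrtOneAddSq H * cfc (invSqrtSum n) (invOneAddSq H)‖ ≤ 1 := by
  have hspec := spectrum_invOneAddSq_subset hH
  rw [invSqrtOneAddSq_eq_cfc hH, ← cfc_mul _ _ _ (by fun_prop)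
    ((continuousOn_invSqrtSum n).mono (hspec.trans Set.Icc_subset_Ici_self))]
  refine norm_cfc_le zero_le_one fun t ht => ?_
  obtain ⟨ht₀, ht₁⟩ := hspec ht
  rw [Real.norm_of_nonneg (mul_nonneg (Real.sqrt_nonneg t) (invSqrtSum_nonneg n ht₀))]
  exact sqrt_mul_invSqrtSum_le_one hn ht₀ ht₁

theorem norm_mul_cfc_invSqrtSum_mul_sub_le (hH : IsSelfAdjoint H) {n : ℕ} (hn : n ≠ 0) :
    ‖invSqrtOneAddSq H * cfc (invSqrtSum n) (invOneAddSq H) * invSqrtOneAddSq H -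
      invSqrtOneAddSq H‖ ≤ (n : ℝ)⁻¹ := by
  have hspec := spectrum_invOneAddSq_subset hH
  have hcont := (continuousOn_invSqrtSum n).mono (hspec.trans Set.Icc_subset_Ici_self)
  have hsqrt : ContinuousOn Real.sqrt (spectrum ℝ (invOneAddSq H)) := by fun_prop
  rw [invSqrtOneAddSq_eq_cfc hH, ← cfc_mul _ _ _ hsqrt hcont,
    ← cfc_mul (fun t => √t * invSqrtSum n t) _ _ (hsqrt.mul hcont) hsqrt,
    ← cfc_sub (fun t => √t * invSqrtSum n t * √t) _ _ ((hsqrt.mul hcont).mul hsqrt) hsqrt]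
  refine norm_cfc_le (by positivity) fun t ht => ?_
  obtain ⟨ht₀, ht₁⟩ := hspec ht
  have hle : t * invSqrtSum n t ≤ √t := by
    have := mul_le_mul_of_nonneg_left (sqrt_mul_invSqrtSum_le_one hn ht₀ ht₁) (Real.sqrt_nonneg t)
    rwa [mul_one, ← mul_assoc, Real.mul_self_sqrt ht₀] at this
  rw [mul_right_comm, Real.mul_self_sqrt ht₀, Real.norm_of_nonpos (sub_nonpos.2 hle), neg_sub]
  exact sqrt_sub_mul_invSqrtSum_le hn ht₀ ht₁

theorem tendsto_boundedTransformSum_apply (hH : IsSelfAdjoint H) (x : E) :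
    Filter.Tendsto (fun n => boundedTransformSum H (n + 1) x) Filter.atTop
      (nhds (boundedTransformCLM H x)) := by
  simp only [boundedTransformSum_eq hH]
  refine ((boundedTransformCLM H).continuous.tendsto x).comp
    (tendsto_apply_of_tendsto_comp (c := 1) (denseRange_invSqrtOneAddSq hH)
      (fun n => norm_invSqrtOneAddSq_mul_cfc_le_one hH n.succ_ne_zero)
      (tendsto_iff_norm_sub_tendsto_zero.2 ?_) x)
  refine squeeze_zero (fun _ => norm_nonneg _)
    (fun n => norm_mul_cfc_invSqrtSum_mul_sub_le hH n.succ_ne_zero) ?_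
  exact (tendsto_inv_atTop_nhds_zero_nat (𝕜 := ℝ)).comp (Filter.tendsto_add_atTop_nat 1)

end FunctionalCalculus

section Estimate

variable {E : Type*} [NormedAddCommGroup E] [InnerProductSpace ℂ E] [CompleteSpace E]
  {D H : E →ₗ.[ℂ] E} {C : E →L[ℂ] E}

theorem norm_inner_map_le_of_isSelfAdjoint_mul {S c : E →L[ℂ] E} (hS : 0 ≤ S)
    (hc : IsSelfAdjoint (S * c)) (x y : E) :
    ‖⟪S (c x), y⟫_ℂ‖ ≤ ‖c‖ * ‖CFC.sqrt S x‖ * ‖CFC.sqrt S y‖ := by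
  have hsa : IsSelfAdjoint (CFC.sqrt S) := .of_nonneg (CFC.sqrt_nonneg S)
  have hsqrt : ∀ u v, ⟪S u, v⟫_ℂ = ⟪CFC.sqrt S u, CFC.sqrt S v⟫_ℂ := fun u v =>
    (congrArg (fun A : E →L[ℂ] E => ⟪A u, v⟫_ℂ) (CFC.sqrt_mul_sqrt_self S hS).symm).trans
      (hsa.isSymmetric (CFC.sqrt S u) v)
  have hsymm : ∀ u v, ⟪CFC.sqrt S (c u), CFC.sqrt S v⟫_ℂ = ⟪CFC.sqrt S u, CFC.sqrt S (c v)⟫_ℂ :=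
    fun u v => calc
      _ = ⟪S (c u), v⟫_ℂ := (hsqrt _ _).symm
      _ = ⟪u, S (c v)⟫_ℂ := hc.isSymmetric u v
      _ = ⟪S u, c v⟫_ℂ := ((IsSelfAdjoint.of_nonneg hS).isSymmetric u (c v)).symm
      _ = _ := hsqrt _ _
  rw [hsqrt]
  refine (norm_inner_le_norm _ _).trans ?_
  gcongr
  exact norm_map_le_of_inner_map_comm _ c hsymm x

theorem invSqrtOneAddSq_nonneg (H : E →ₗ.[ℂ] E) : 0 ≤ invSqrtOneAddSq H := CFC.sqrt_nonneg _

theorem exists_invSqrtOneAddSq_mul_eq (hH : IsSelfAdjoint H) (C : E →L[ℂ] E) :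
    ∃ c, ‖c‖ ≤ ‖C‖ ∧ invSqrtOneAddSq H * c = resolventCLM H Complex.I * C := by
  obtain ⟨W, hW, hWS⟩ := exists_mul_eq_of_norm_le (denseRange_invSqrtOneAddSq hH)
    fun x => (norm_resolventCLM_neg_I_apply hH x).le
  refine ⟨star W * C, ?_, ?_⟩
  · refine (norm_mul_le _ _).trans (mul_le_of_le_one_left (norm_nonneg C) ?_)
    rwa [norm_star]
  · have h := congrArg star hWS
    rw [← ContinuousLinearMap.mul_def, star_mul, isSelfAdjoint_invSqrtOneAddSq H,
      star_resolventCLM hH (by simp), star_neg, Complex.star_def, Complex.conj_I, neg_neg] at h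
    rw [← mul_assoc, h]

theorem norm_inner_resolventCLM_I_mul_le (hD : IsSelfAdjoint D) (hH : IsSelfAdjoint H)
    (hC : HasCommutator D (resolventCLM H (-Complex.I)) (-(resolventCLM H (-Complex.I) * C)))
    (x y : E) : ‖⟪resolventCLM H Complex.I (C x), y⟫_ℂ‖ ≤
      ‖C‖ * ‖CFC.sqrt (invSqrtOneAddSq H) x‖ * ‖CFC.sqrt (invSqrtOneAddSq H) y‖ := by
  obtain ⟨c, hcC, hc⟩ := exists_invSqrtOneAddSq_mul_eq hH C
  have hskew : star (resolventCLM H Complex.I * C) = -(resolventCLM H Complex.I * C) := by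
    simpa using star_resolventCLM_mul hD hH (by simp) hC
  have hsa : IsSelfAdjoint (invSqrtOneAddSq H * (Complex.I • c)) := by
    rw [mul_smul_comm, hc, IsSelfAdjoint, star_smul, hskew, Complex.star_def, Complex.conj_I,
      neg_smul_neg]
  have h := norm_inner_map_le_of_isSelfAdjoint_mul (invSqrtOneAddSq_nonneg H) hsa x y
  have hcx : invSqrtOneAddSq H (c x) = resolventCLM H Complex.I (C x) := DFunLike.congr_fun hc x
  rw [smul_apply, map_smul, inner_smul_left, norm_mul, Complex.conj_I, norm_neg, Complex.norm_I,
    one_mul, hcx, norm_smul, Complex.norm_I, one_mul] at h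
  exact h.trans (by gcongr)

/-- The operator `(1 + H²)^(-1/4) (H + i) (H - iμ)⁻¹`. -/
noncomputable def cayleyWeight (H : E →ₗ.[ℂ] E) (μ : ℝ) : E →L[ℂ] E :=
  CFC.sqrt (invSqrtOneAddSq H) * cayley H (-Complex.I) (Complex.I * μ)

theorem star_cayleyWeight_mul_self (hH : IsSelfAdjoint H) {μ : ℝ} (hμ : 1 ≤ μ ^ 2) :
    star (cayleyWeight H μ) * cayleyWeight H μ =
      invSqrtOneAddSq H * cfc (cayleySq μ) (invOneAddSq H) := by
  have hμ' : (Complex.I * μ).im ≠ 0 := by simpa using ne_zero_of_one_le_sq hμ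
  have hsa : IsSelfAdjoint (CFC.sqrt (invSqrtOneAddSq H)) := .of_nonneg (CFC.sqrt_nonneg _)
  have hcomm : Commute (invSqrtOneAddSq H) (star (cayley H (-Complex.I) (Complex.I * μ))) := by
    rw [star_cayley hH hμ']
    refine (commute_invSqrtOneAddSq hH fun z hz =>
      (commute_cayley_resolventCLM hH (by simpa using hμ') hz).symm)
  have hstar : star (cayley H (-Complex.I) (Complex.I * μ)) =
      cayley H Complex.I (-(Complex.I * μ)) := by
    rw [star_cayley hH hμ']
    simp
  rw [cayleyWeight, star_mul, hsa, mul_assoc, ← mul_assoc (CFC.sqrt _),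
    CFC.sqrt_mul_sqrt_self _ (invSqrtOneAddSq_nonneg H), ← mul_assoc, ← hcomm.eq, mul_assoc, hstar,
    cfc_cayleySq_invOneAddSq hH hμ]

theorem norm_cayleyWeight_neg_apply (hH : IsSelfAdjoint H) {μ : ℝ} (hμ : 1 ≤ μ ^ 2) (x : E) :
    ‖cayleyWeight H (-μ) x‖ = ‖cayleyWeight H μ x‖ := by
  refine norm_map_eq_of_star_mul_self_eq ?_ x
  rw [star_cayleyWeight_mul_self hH hμ, star_cayleyWeight_mul_self hH (by rwa [neg_sq])]
  congr 2
  ext t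
  rw [cayleySq, cayleySq, neg_sq]

theorem sum_norm_cayleyWeight_sq_le (hH : IsSelfAdjoint H) {n : ℕ} (hn : n ≠ 0) (x : E) :
    ∑ k ∈ Finset.range n, secNode n k ^ 2 / n * ‖cayleyWeight H (secNode n k) x‖ ^ 2 ≤
      ‖x‖ ^ 2 := by
  have hterm : ∀ k ∈ Finset.range n,
      secNode n k ^ 2 / n * ‖cayleyWeight H (secNode n k) x‖ ^ 2 = (⟪(invSqrtOneAddSq H *
        ((secNode n k ^ 2 / n) • cfc (cayleySq (secNode n k)) (invOneAddSq H))) x, x⟫_ℂ).re :=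
    fun k hk => by
      rw [ContinuousLinearMap.apply_norm_sq_eq_inner_adjoint_left, mul_smul_comm,
        ← star_cayleyWeight_mul_self hH (one_le_secNode_sq (Finset.mem_range.1 hk)),
        ← Complex.coe_smul, smul_apply, inner_smul_left, Complex.conj_ofReal, Complex.re_ofReal_mul]
      rfl
  calc _ = (⟪(invSqrtOneAddSq H * cfc (invSqrtSum n) (invOneAddSq H)) x, x⟫_ℂ).re := by
        rw [Finset.sum_congr rfl hterm, cfc_invSqrtSum hH, Finset.mul_sum, sum_apply, sum_inner,
          Complex.re_sum]
    _ ≤ ‖(invSqrtOneAddSq H * cfc (invSqrtSum n) (invOneAddSq H)) x‖ * ‖x‖ :=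
        re_inner_le_norm (𝕜 := ℂ) _ _
    _ ≤ 1 * ‖x‖ * ‖x‖ := by
        gcongr
        exact ContinuousLinearMap.le_of_opNorm_le _ (norm_invSqrtOneAddSq_mul_cfc_le_one hH hn) x
    _ = ‖x‖ ^ 2 := by ring

theorem sum_norm_cayleyWeight_mul_le (hH : IsSelfAdjoint H) {n : ℕ} (hn : n ≠ 0) (x y : E) :
    ∑ k ∈ Finset.range n, secNode n k ^ 2 / n *
      (‖cayleyWeight H (secNode n k) x‖ * ‖cayleyWeight H (secNode n k) y‖) ≤ ‖x‖ * ‖y‖ := by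
  refine le_of_sq_le_sq ?_ (by positivity)
  calc _ ≤ (∑ k ∈ Finset.range n, secNode n k ^ 2 / n * ‖cayleyWeight H (secNode n k) x‖ ^ 2) *
        ∑ k ∈ Finset.range n, secNode n k ^ 2 / n * ‖cayleyWeight H (secNode n k) y‖ ^ 2 :=
        Finset.sum_sq_le_sum_mul_sum_of_sq_le_mul _ (fun _ _ => by positivity)
          (fun _ _ => by positivity) fun _ _ => le_of_eq (by ring)
    _ ≤ ‖x‖ ^ 2 * ‖y‖ ^ 2 := by
        gcongr <;> exact sum_norm_cayleyWeight_sq_le hH hn _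
    _ = (‖x‖ * ‖y‖) ^ 2 := by ring

theorem exists_hasCommutator_resolventCLM_norm_inner_le (hD : IsSelfAdjoint D)
    (hH : IsSelfAdjoint H)
    (hC : HasCommutator D (resolventCLM H (-Complex.I)) (-(resolventCLM H (-Complex.I) * C)))
    {μ : ℝ} (hμ : 1 ≤ μ ^ 2) : ∃ K, HasCommutator D (resolventCLM H (Complex.I * μ)) K ∧
      ∀ x y, ‖⟪K x, y⟫_ℂ‖ ≤ ‖C‖ * ‖cayleyWeight H μ x‖ * ‖cayleyWeight H μ y‖ := by
  have hμ' : (Complex.I * μ).im ≠ 0 := by simpa using ne_zero_of_one_le_sq hμ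
  refine ⟨_, hasCommutator_resolventCLM_star_cayley hD hH hμ' (by simp) hC, fun x y => ?_⟩
  have hstar : star (Complex.I * μ) = Complex.I * (-μ : ℝ) := by simp
  have h := norm_inner_resolventCLM_I_mul_le hD hH hC
    (cayley H (-Complex.I) (Complex.I * μ) x) (cayley H (-Complex.I) (Complex.I * (-μ : ℝ)) y)
  rw [neg_apply, inner_neg_left, norm_neg, ← norm_cayleyWeight_neg_apply hH hμ y, hstar]
  refine Eq.trans_le ?_ h
  rw [ContinuousLinearMap.star_eq_adjoint]
  simp [ContinuousLinearMap.adjoint_inner_left]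

theorem exists_hasCommutator_boundedTransformSum (hD : IsSelfAdjoint D) (hH : IsSelfAdjoint H)
    (hC : HasCommutator D (resolventCLM H (-Complex.I)) (-(resolventCLM H (-Complex.I) * C)))
    {n : ℕ} (hn : n ≠ 0) : ∃ K, HasCommutator D (boundedTransformSum H n) K ∧
      ∀ x y, ‖⟪K x, y⟫_ℂ‖ ≤ ‖C‖ * ‖x‖ * ‖y‖ := by
  choose! K hK hKle using fun (μ : ℝ) (hμ : 1 ≤ μ ^ 2) =>
    exists_hasCommutator_resolventCLM_norm_inner_le hD hH hC hμ
  have hnode : ∀ k ∈ Finset.range n, 1 ≤ secNode n k ^ 2 := fun k hk =>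
    one_le_secNode_sq (Finset.mem_range.1 hk)
  have hnode' : ∀ k ∈ Finset.range n, 1 ≤ (-secNode n k) ^ 2 := by simpa only [neg_sq] using hnode
  refine ⟨∑ k ∈ Finset.range n, ((secNode n k ^ 2 / n / 2 : ℝ) : ℂ) •
    (K (secNode n k) + K (-secNode n k)), .sum fun k hk => ?_, fun x y => ?_⟩
  · have hneg := hK _ (hnode' k hk)
    rw [Complex.ofReal_neg, mul_neg] at hneg
    exact ((hK _ (hnode k hk)).add hneg).smul _
  · have hterm : ∀ k ∈ Finset.range n, ‖⟪(((secNode n k ^ 2 / n / 2 : ℝ) : ℂ) •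
        (K (secNode n k) + K (-secNode n k))) x, y⟫_ℂ‖ ≤ ‖C‖ * (secNode n k ^ 2 / n *
          (‖cayleyWeight H (secNode n k) x‖ * ‖cayleyWeight H (secNode n k) y‖)) := fun k hk => by
      have hpos := hKle _ (hnode k hk) x y
      have hneg := hKle _ (hnode' k hk) x y
      rw [norm_cayleyWeight_neg_apply hH (hnode k hk),
        norm_cayleyWeight_neg_apply hH (hnode k hk)] at hneg
      rw [smul_apply, add_apply, inner_smul_left, inner_add_left, norm_mul, RCLike.norm_conj,
        Complex.norm_real, Real.norm_of_nonneg (by positivity)]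
      calc _ ≤ secNode n k ^ 2 / n / 2 * (‖⟪K (secNode n k) x, y⟫_ℂ‖ +
            ‖⟪K (-secNode n k) x, y⟫_ℂ‖) := by gcongr; exact norm_add_le _ _
        _ ≤ secNode n k ^ 2 / n / 2 * (2 * (‖C‖ * ‖cayleyWeight H (secNode n k) x‖ *
            ‖cayleyWeight H (secNode n k) y‖)) := by gcongr; linarith
        _ = _ := by ring
    rw [sum_apply, sum_inner, mul_assoc]
    refine (norm_sum_le_of_le _ hterm).trans ?_
    rw [← Finset.mul_sum]
    gcongr
    exact sum_norm_cayleyWeight_mul_le hH hn x y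

theorem exists_hasCommutator_boundedTransformCLM (hD : IsSelfAdjoint D) (hH : IsSelfAdjoint H)
    (hC : HasCommutator D (resolventCLM H (-Complex.I)) (-(resolventCLM H (-Complex.I) * C))) :
    ∃ K, HasCommutator D (boundedTransformCLM H) K ∧ ‖K‖ ≤ ‖C‖ := by
  choose K hK hKle using fun n : ℕ =>
    exists_hasCommutator_boundedTransformSum hD hH hC n.succ_ne_zero
  exact HasCommutator.exists_of_tendsto hD (norm_nonneg C) hK hKle
    (tendsto_boundedTransformSum_apply hH)

end Estimate

section BoundedOperator

variable {E : Type*} [NormedAddCommGroup E] [InnerProductSpace ℂ E]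

theorem hasCore_domain {D : E →ₗ.[ℂ] E} (hD : D.IsClosed) : D.HasCore D.domain where
  le_domain := le_rfl
  closure_eq := by
    rw [(LinearPMap.ext (by simp) fun x _ _ => rfl : D.domRestrict D.domain = D)]
    exact LinearPMap.eq_of_eq_graph
      (hD.isClosable.graph_closure_eq_closure_graph.symm.trans hD.submodule_topologicalClosure_eq)

variable [CompleteSpace E] {N : VonNeumannAlgebra E} {D : E →ₗ.[ℂ] E} {m K : E →L[ℂ] E}

theorem isSelfAdjoint_ofBounded (hm : IsSelfAdjoint m) : IsSelfAdjoint (ofBounded m) :=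
  (ContinuousLinearMap.toPMap_adjoint_eq_adjoint_toPMap_of_dense m (by simp)).trans
    (congrArg ofBounded hm)

theorem isAffiliated_ofBounded (hm : IsSelfAdjoint m) (hmN : m ∈ N) :
    IsAffiliated N (ofBounded m) where
  isClosed := (isSelfAdjoint_ofBounded hm).isClosed
  dense_domain := (isSelfAdjoint_ofBounded hm).dense_domain
  commute _ _ hUN x :=
    ⟨trivial, DFunLike.congr_fun (VonNeumannAlgebra.mem_commutant_iff.1 hUN m hmN) (x : E)⟩

theorem hasCommutator_resolventCLM_ofBounded {z : ℂ} (hD : IsSelfAdjoint D)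
    (hm : IsSelfAdjoint m) (hK : HasCommutator D m K) (hz : z.im ≠ 0) :
    HasCommutator D (resolventCLM (ofBounded m) z)
      (-(resolventCLM (ofBounded m) z * K * resolventCLM (ofBounded m) z)) := by
  have hm' := isSelfAdjoint_ofBounded hm
  have hsub : HasCommutator D (m - z • 1) K := by
    simpa using hK.sub (HasCommutator.one.smul z)
  refine hsub.inv hD (ContinuousLinearMap.ext fun x => ?_) (ContinuousLinearMap.ext fun x => ?_)
  · obtain ⟨_, hmr⟩ := resolventCLM_spec hm' hz x
    exact sub_eq_iff_eq_add.2 hmr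
  · exact (resolventCLM_eq_iff hm' hz).2 ⟨trivial, (sub_add_cancel _ _).symm⟩

theorem isDifferentiable_ofBounded (hD : IsSelfAdjoint D) (hDN : IsAffiliated N D)
    (hm : IsSelfAdjoint m) (hmN : m ∈ N) (hK : HasCommutator D m K) :
    IsDifferentiable N D (ofBounded m) := by
  have hm' := isSelfAdjoint_ofBounded hm
  have hmN' := isAffiliated_ofBounded hm hmN
  have him : ∀ {μ : ℝ}, μ ≠ 0 → (Complex.I * μ).im ≠ 0 := fun hμ => by simpa using hμ
  have hr : ∀ {μ : ℝ}, μ ≠ 0 → ∀ x ∈ D.domain,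
      resolventCLM (ofBounded m) (Complex.I * μ) x ∈ D.domain := fun hμ x hx =>
    (hasCommutator_resolventCLM_ofBounded hD hm hK (him hμ) ⟨x, hx⟩).1
  refine ⟨hm', hmN', D.domain, hasCore_domain hD.isClosed, fun μ hμ x hx => ?_, fun μ hμ =>
    ⟨K * resolventCLM (ofBounded m) (Complex.I * μ),
      mul_mem (hK.mem hDN hmN) (hmN'.resolventCLM_mem hm' (him hμ)), fun x hx => ?_⟩⟩ <;>
    rw [← ofBounded_resolventCLM hm' (him hμ)]
  · exact ⟨trivial, trivial, hr hμ x hx, trivial⟩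
  · obtain ⟨hdom, hKr⟩ := hK.extendsFrom _ (hr hμ x hx)
    exact ⟨mem_pcomp_domain.2 ⟨trivial, hdom⟩, hKr⟩

end BoundedOperator

end Callias

theorem mainTheorem9_general {E : Type*} [NormedAddCommGroup E] [InnerProductSpace ℂ E]
    [CompleteSpace E] (N : VonNeumannAlgebra E) (D : E →ₗ.[ℂ] E) (hD : IsSelfAdjoint D)
    (hDN : Callias.IsAffiliated N D) (H : E →ₗ.[ℂ] E) (hdiff : Callias.IsDifferentiable N D H) :
    Callias.IsDifferentiable N D (Callias.boundedTransform H) ∧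
    ∃ K ∈ N,
      Callias.ExtendsFrom (Callias.commutator D (Callias.boundedTransform H)) D.domain K ∧
      ∀ (V : Submodule ℂ E) (C : E →L[ℂ] E),
        Callias.IsDifferentiableOnCore N D H V →
        Callias.ExtendsFrom
          (Callias.pcomp (Callias.commutator D H) (Callias.resolvent H (-Complex.I))) V C →
        ‖K‖ ≤ ‖C‖ := by
  have hH := hdiff.isSelfAdjoint
  have hFN := hdiff.isAffiliated.boundedTransformCLM_mem hH
  have hcore : ∀ V C, Callias.IsDifferentiableOnCore N D H V → Callias.ExtendsFrom
      (Callias.pcomp (Callias.commutator D H) (Callias.resolvent H (-Complex.I))) V C →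
      ∃ K, Callias.HasCommutator D (Callias.boundedTransformCLM H) K ∧ ‖K‖ ≤ ‖C‖ :=
    fun V C hV hC => Callias.exists_hasCommutator_boundedTransformCLM hD hH
      (Callias.hasCommutator_resolventCLM_of_extendsFrom hD.isClosed hV.hasCore hH (by simp) hC)
  obtain ⟨V, hV⟩ := hdiff.exists_core
  obtain ⟨C, -, hC⟩ := hV.bounded (-1) (by simp)
  obtain ⟨K, hK, -⟩ := hcore V C hV (by simpa using hC)
  rw [← Callias.ofBounded_boundedTransformCLM hH]
  refine ⟨Callias.isDifferentiable_ofBounded hD hDN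
    (Callias.isSelfAdjoint_boundedTransformCLM hH) hFN hK, K, hK.mem hDN hFN, hK.extendsFrom,
    fun V' C' hV' hC' => ?_⟩
  obtain ⟨K', hK', hle⟩ := hcore V' C' hV' hC'
  rwa [hK.unique hD.dense_domain hK']

theorem mainTheorem9 {E : Type*} [NormedAddCommGroup E] [InnerProductSpace ℂ E] [CompleteSpace E]
    (N : VonNeumannAlgebra E) (τ : (E →L[ℂ] E) → ENNReal) (D : E →ₗ.[ℂ] E)
    (𝒜 : NonUnitalStarSubalgebra ℂ (E →L[ℂ] E))
    (htriple : Callias.IsSemifiniteSpectralTriple N τ D 𝒜)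
    (H : E →ₗ.[ℂ] E)
    (hmult : Callias.IsUnboundedMultiplier 𝒜.topologicalClosure N H)
    (hdiff : Callias.IsDifferentiable N D H) :
    Callias.IsDifferentiable N D (Callias.boundedTransform H) ∧
    ∃ K ∈ N,
      Callias.ExtendsFrom (Callias.commutator D (Callias.boundedTransform H)) D.domain K ∧
      ∀ (V : Submodule ℂ E) (C : E →L[ℂ] E),
        Callias.IsDifferentiableOnCore N D H V →
        Callias.ExtendsFrom
          (Callias.pcomp (Callias.commutator D H) (Callias.resolvent H (-Complex.I))) V C →
        ‖K‖ ≤ ‖C‖ :=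
  mainTheorem9_general N D htriple.isSelfAdjoint htriple.isAffiliated H hdiff
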